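/- Let $1<p<\infty$, $\frac1p+\frac1{p'}=1$. For $0<G_0\le G_1$, a function $G:(0,1)\times\mathbb R\to\mathbb R$ satisfies (H) with bounds $G_0,G_1$ if $G_0\le G(x,y)\le G_1$ for all $(x,y)\in(0,1)\times\mathbb R$; there is $L>0$ with $G(x,y+L)=G(x,y)$ for all $(x,y)$; and there are finitely many points $0=\xi_0<\xi_1<\dots<\xi_N=1$ such that on each strip $(\xi_{i-1},\xi_i)\times\mathbb R$ the function $G$ is $C^1$, and $G,\partial_xG,\partial_yG$ are bounded there and, for each $y$, have limits as $x\downarrow\xi_{i-1}$ and as $x\uparrow\xi_i$. For $\varepsilon>0$ put $G_\varepsilon(x)=G(x,x/\varepsilon)$ and $$R^\varepsilon=\{(x,y)\in\mathbb R^2:\ 0<x<1,\ 0<y<\varepsilon G_\varepsilon(x)\},$$ and define $\hat G_\varepsilon$, $\hat R^\varepsilon$ from $\hat G$ in the same way. For measurable $U\subset\mathbb R^2$ let $$|||w|||_{L^{q}(U)}=\varepsilon^{-1/q}\|w\|_{L^{q}(U)},\qquad |||w|||_{W^{1,p}(U)}=\varepsilon^{-1/p}\Big(\int_U |\nabla w|^p+|w|^p\,dx\,dy\Big)^{1/p}.$$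 Given $f^\varepsilon\in L^{p'}(\mathbb R^2)$, a weak solution in $R^\varepsilon$ is a function $u_\varepsilon\in W^{1,p}(R^\varepsilon)$ with $$\int_{R^\varepsilon}\big\{|\nabla u_\varepsilon|^{p-2}\nabla u_\varepsilon\cdot\nabla\varphi+|u_\varepsilon|^{p-2}u_\varepsilon\varphi\big\}\,dx\,dy=\int_{R^\varepsilon}f^\varepsilon\varphi\,dx\,dy\qquad\text{for all }\varphi\in W^{1,p}(R^\varepsilon)$$ (the Neumann problem for $-\Delta_pu+|u|^{p-2}u=f^\varepsilon$), and similarly $\hat u_\varepsilon$ in $\hat R^\varepsilon$ with the same $f^\varepsilon$. **Theorem.** Let $1<p<\infty$, and let $G_0,G_1,\varepsilon_0>0$ and $C\ge0$ be constants. There is a function $\rho:[0,\infty)\to[0,\infty)$, depending only on $p,G_0,G_1,\varepsilon_0,C$, with $\rho(\delta)\to0$ as $\delta\to0$ (and $\rho(0)=0$), such that the following holds for every $0<\varepsilon\le\varepsilon_0$ and every $\delta\ge0$. If $G,\hat G$ satisfy (H) with bounds $G_0,G_1$ (the points $\xi_i$ and the periods may differ) and $$\sup_{0<x<1}|G_\varepsilon(x)-\hat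 G_\varepsilon(x)|\le\delta,$$ if $f^\varepsilon\in L^{p'}(\mathbb R^2)$ satisfies $|||f^\varepsilon|||_{L^{p'}(R^\varepsilon\cup\hat R^\varepsilon)}\le C$, and if $u_\varepsilon$, $\hat u_\varepsilon$ are the weak solutions in $R^\varepsilon$, $\hat R^\varepsilon$, then $$|||u_\varepsilon-\hat u_\varepsilon|||^p_{W^{1,p}(R^\varepsilon\cap\hat R^\varepsilon)}+|||u_\varepsilon|||^p_{W^{1,p}(R^\varepsilon\setminus\hat R^\varepsilon)}+|||\hat u_\varepsilon|||^p_{W^{1,p}(\hat R^\varepsilon\setminus R^\varepsilon)}\le\rho(\delta).$$ -/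

import Mathlib

open MeasureTheory Set Filter Topology
open scoped ENNReal NNReal ContDiff

namespace ThinDomain

/-- Gradient vectors in the plane, with the Euclidean norm and inner product. -/
abbrev Vec : Type := EuclideanSpace ℝ (Fin 2)

/-- `F x y` has, for every `y`, finite limits as `x ↓ a` and as `x ↑ b`. -/
def HasEndLimits (F : ℝ → ℝ → ℝ) (a b : ℝ) : Prop :=
  ∀ y : ℝ, (∃ l : ℝ, Tendsto (fun x => F x y) (𝓝[>] a) (𝓝 l)) ∧
    (∃ l : ℝ, Tendsto (fun x => F x y) (𝓝[<] b) (𝓝 l))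

/-- Regularity of the profile on one strip `(a, b) × ℝ`: `G` is `C¹` there, and `G`, `∂ₓG`, `∂ᵧG`
are bounded on the strip and have limits when `x` approaches `a` and `b`. -/
def RegularOnStrip (G : ℝ → ℝ → ℝ) (a b : ℝ) : Prop :=
  ContDiffOn ℝ 1 (fun z : ℝ × ℝ => G z.1 z.2) (Ioo a b ×ˢ univ) ∧
  (∃ M : ℝ, ∀ x ∈ Ioo a b, ∀ y : ℝ,
    |G x y| ≤ M ∧ |deriv (fun s => G s y) x| ≤ M ∧ |deriv (fun t => G x t) y| ≤ M) ∧
  HasEndLimits G a b ∧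
  HasEndLimits (fun x y => deriv (fun s => G s y) x) a b ∧
  HasEndLimits (fun x y => deriv (fun t => G x t) y) a b

/-- Hypothesis (H) on a profile `G : (0,1) × ℝ → ℝ` with bounds `G₀`, `G₁`. The values of `G x y`
for `x` outside `(0,1)` are irrelevant. -/
structure HypH (G₀ G₁ : ℝ) (G : ℝ → ℝ → ℝ) : Prop where
  pos : 0 < G₀
  bounds : ∀ x ∈ Ioo (0 : ℝ) 1, ∀ y : ℝ, G₀ ≤ G x y ∧ G x y ≤ G₁
  periodic : ∃ L : ℝ, 0 < L ∧ ∀ x ∈ Ioo (0 : ℝ) 1, ∀ y : ℝ, G x (y + L) = G x y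
  piecewise : ∃ (N : ℕ) (ξ : Fin (N + 1) → ℝ), StrictMono ξ ∧ ξ 0 = 0 ∧ ξ (Fin.last N) = 1 ∧
    ∀ i : Fin N, RegularOnStrip G (ξ i.castSucc) (ξ i.succ)

/-- The oscillating profile `G_ε(x) = G(x, x/ε)`. -/
noncomputable def profile (G : ℝ → ℝ → ℝ) (ε x : ℝ) : ℝ := G x (x / ε)

/-- The thin domain `R^ε = {(x,y) : 0 < x < 1, 0 < y < ε G_ε(x)}`. -/
def thinDomain (G : ℝ → ℝ → ℝ) (ε : ℝ) : Set (ℝ × ℝ) :=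
  {z | z.1 ∈ Ioo (0 : ℝ) 1 ∧ 0 < z.2 ∧ z.2 < ε * profile G ε z.1}

/-- `Du` is the distributional gradient of `u` in `U`: integration by parts against every smooth
function with compact support contained in `U`. -/
def IsWeakGradient (U : Set (ℝ × ℝ)) (u : ℝ × ℝ → ℝ) (Du : ℝ × ℝ → Vec) : Prop :=
  ∀ φ : ℝ × ℝ → ℝ, ContDiff ℝ ∞ φ → HasCompactSupport φ → tsupport φ ⊆ U →
    (∫ z in U, u z * fderiv ℝ φ z (1, 0) = -∫ z in U, Du z 0 * φ z) ∧
    (∫ z in U, u z * fderiv ℝ φ z (0, 1) = -∫ z in U, Du z 1 * φ z)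

/-- `u ∈ W^{1,p}(U)`, with weak gradient `Du` (which is determined by `u` almost everywhere). -/
structure MemSobolev (p : ℝ) (U : Set (ℝ × ℝ)) (u : ℝ × ℝ → ℝ) (Du : ℝ × ℝ → Vec) : Prop where
  memLp : MemLp u (ENNReal.ofReal p) (volume.restrict U)
  memLp_grad : MemLp Du (ENNReal.ofReal p) (volume.restrict U)
  weakGradient : IsWeakGradient U u Du

/-- `u ∈ W^{1,p}(U)`, with weak gradient `Du`, is a weak solution of the homogeneous Neumann problem
`-Δₚ u + |u|^{p-2} u = f` in `U`, `|∇u|^{p-2} ∇u · η = 0` on `∂U`. -/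
structure IsWeakSolution (p : ℝ) (U : Set (ℝ × ℝ)) (f u : ℝ × ℝ → ℝ) (Du : ℝ × ℝ → Vec) :
    Prop where
  memSobolev : MemSobolev p U u Du
  weak_eq : ∀ (φ : ℝ × ℝ → ℝ) (Dφ : ℝ × ℝ → Vec), MemSobolev p U φ Dφ →
    ∫ z in U, (‖Du z‖ ^ (p - 2) * inner ℝ (Du z) (Dφ z) + |u z| ^ (p - 2) * u z * φ z) =
      ∫ z in U, f z * φ z

/-- The rescaled norm `|||f|||_{L^q(U)} = ε^{-1/q} ‖f‖_{L^q(U)}`. -/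
noncomputable def rescaledLpNorm (ε q : ℝ) (U : Set (ℝ × ℝ)) (f : ℝ × ℝ → ℝ) : ℝ≥0∞ :=
  ENNReal.ofReal ε ^ (-(1 / q)) * eLpNorm f (ENNReal.ofReal q) (volume.restrict U)

/-- The norm `‖w‖_{W^{1,p}(U)} = (∫_U |w|^p + |∇w|^p)^{1/p}`, where `Dw` is the gradient of `w`.
It is also used on measurable sets `U` that are not open. -/
noncomputable def sobolevNorm (p : ℝ) (U : Set (ℝ × ℝ)) (w : ℝ × ℝ → ℝ) (Dw : ℝ × ℝ → Vec) :
    ℝ≥0∞ :=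
  (∫⁻ z in U, (‖w z‖ₑ ^ p + ‖Dw z‖ₑ ^ p)) ^ (1 / p)

/-- The rescaled norm `|||w|||_{W^{1,p}(U)} = ε^{-1/p} ‖w‖_{W^{1,p}(U)}`. -/
noncomputable def rescaledSobolevNorm (ε p : ℝ) (U : Set (ℝ × ℝ)) (w : ℝ × ℝ → ℝ)
    (Dw : ℝ × ℝ → Vec) : ℝ≥0∞ :=
  ENNReal.ofReal ε ^ (-(1 / p)) * sobolevNorm p U w Dw

end ThinDomain

/-! A weak solution `u` minimises `E(v)/p - ∫ f v`, where `E` is the `p`-energy. By Young's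
inequality this reads `∫ f v ≤ E(u)/q + E(v)/p`, with equality at `v = u`
(`IsWeakSolution.integral_mul_le`, `IsWeakSolution.integral_eq_energy`). The two solutions are
compared through their midpoint `w`, which exists only on the intersection of the domains.

To make `w` admissible on either domain, it is replaced by `w(x, y/(1+η))` with `η = δ/G₀`. Since
the heights differ by at most `η` times their lower bound, stretching the intersection vertically by
`1+η` covers both domains. No smoothness of the boundary enters, and the energy grows at most by the
factor `1+η`. On almost every vertical line a Sobolev function is Hölder continuous, so stretching
moves `w` little in `L^p` (`MemSobolev.lintegral_sub_stretch_le`), and the `L^p` mass on the thin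
strips between the graphs is small (`MemSobolev.lintegral_strip_le`).

Adding the two minimality inequalities shows that the mean of the two full energies exceeds `E(w)`
by a small error (`energy_sub_add_energy_diff_le`). This excess contains half the energies on the
set differences and the convexity defect on the intersection. Uniform convexity of `‖·‖^p`
(`exists_norm_sub_rpow_le`) turns the defect into a bound for `u - û`, up to a multiple `θ` of the
energies; optimising over `θ` gives the modulus (`exists_modulus`).

All bounds are linear in `M = C^q ε`, so dividing by `ε` leaves constants independent of `ε`. -/

namespace ThinDomain

/-! ### Weak vertical derivatives and Hölder continuity on vertical lines. -/

/-- Every vertical section of `O` is an interval. -/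
def VerticallyConvex (O : Set (ℝ × ℝ)) : Prop :=
  ∀ x y y' : ℝ, (x, y) ∈ O → (x, y') ∈ O → ∀ t ∈ uIcc y y', (x, t) ∈ O

/-- The integral is the convolution of `g` with the reflected test function, so the derivative falls
on `φ` and `g` need only be locally integrable. -/
theorem hasDerivAt_integral_mul_translate {g : ℝ × ℝ → ℝ} (hg : LocallyIntegrable g)
    {φ : ℝ × ℝ → ℝ} (hφ : ContDiff ℝ ∞ φ) (hφc : HasCompactSupport φ) (e : ℝ × ℝ) (τ : ℝ) :
    HasDerivAt (fun τ : ℝ => ∫ z, g z * φ (z - τ • e))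
      (-∫ z, g z * fderiv ℝ φ (z - τ • e) e) τ := by
  set ψ : ℝ × ℝ → ℝ := fun w => φ (-w) with hψ
  have hψ1 : ContDiff ℝ 1 ψ := (hφ.comp contDiff_neg).of_le (by norm_num)
  have hψc : HasCompactSupport ψ := hφc.comp_homeomorph (Homeomorph.neg _)
  have key := hψc.hasFDerivAt_convolution_right (ContinuousLinearMap.lsmul ℝ ℝ) hg hψ1 (τ • e)
  have hline : HasDerivAt (fun τ : ℝ => τ • e) e τ := by
    simpa using (hasDerivAt_id τ).smul_const e
  have h2 := key.comp_hasDerivAt τ hline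
  have hfd : ∀ w, fderiv ℝ ψ w = -fderiv ℝ φ (-w) := by
    intro w
    have : HasFDerivAt ψ ((fderiv ℝ φ (-w)).comp (-ContinuousLinearMap.id ℝ (ℝ × ℝ))) w :=
      ((hφ.differentiable (by norm_num)) (-w)).hasFDerivAt.comp w (hasFDerivAt_id w).neg
    rw [this.fderiv]; ext <;> simp
  have e1 : (fun τ : ℝ => ∫ z, g z * φ (z - τ • e)) =
      convolution g ψ (ContinuousLinearMap.lsmul ℝ ℝ) volume ∘ fun τ => τ • e := by
    funext τ
    simp [MeasureTheory.convolution, Function.comp, hψ]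
  have e2 : -∫ z, g z * fderiv ℝ φ (z - τ • e) e = convolution g (fderiv ℝ ψ)
      (ContinuousLinearMap.precompR (ℝ × ℝ) (ContinuousLinearMap.lsmul ℝ ℝ)) volume (τ • e) e := by
    have hint : Integrable (fun t => ((ContinuousLinearMap.lsmul ℝ ℝ).precompR (ℝ × ℝ)) (g t)
        (fderiv ℝ ψ (τ • e - t))) volume :=
      (hψc.fderiv (𝕜 := ℝ)).convolutionExists_right
        ((ContinuousLinearMap.lsmul ℝ ℝ).precompR (ℝ × ℝ)) hg
        (hψ1.continuous_fderiv (by norm_num)) (τ • e)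
    rw [convolution_def, ContinuousLinearMap.integral_apply hint, ← integral_neg]
    refine integral_congr_ae (Eventually.of_forall fun z => ?_)
    simp [ContinuousLinearMap.precompR_apply, hfd]
  rw [e1, e2]
  exact h2

/-- Slide a test function vertically by `τ s`, with `τ` from `0` to `1`. If its support lies in `O`
at both ends, vertical convexity keeps it in `O` throughout, so its integral against `g` has zero
derivative in `τ`. Equality at the two ends, for all such test functions, is the claim. -/
theorem ae_translate_eq_of_weak_deriv_eq_zero {O : Set (ℝ × ℝ)} (hO : IsOpen O)
    (hconv : VerticallyConvex O) {g : ℝ × ℝ → ℝ} (hg : LocallyIntegrable g)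
    (h : ∀ φ : ℝ × ℝ → ℝ, ContDiff ℝ ∞ φ → HasCompactSupport φ → tsupport φ ⊆ O →
      ∫ z, g z * fderiv ℝ φ z (0, 1) = 0) (s : ℝ) :
    ∀ᵐ z : ℝ × ℝ, z ∈ O ∩ {z | z + (0, s) ∈ O} → g (z + (0, s)) - g z = 0 := by
  have hgs : LocallyIntegrable (fun z => g (z + (0, s))) := by
    intro z
    obtain ⟨A, hA, hAi⟩ := hg (z + (0, s))
    refine ⟨(fun z => z + (0, s)) ⁻¹' A,
      (by fun_prop : ContinuousAt (fun z : ℝ × ℝ => z + (0, s)) z) hA, ?_⟩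
    exact ((measurePreserving_add_right volume ((0, s) : ℝ × ℝ)).integrableOn_comp_preimage
      (measurableEmbedding_addRight _)).2 hAi
  refine IsOpen.ae_eq_zero_of_integral_contDiff_smul_eq_zero
    (hO.inter (hO.preimage (by fun_prop : Continuous fun z : ℝ × ℝ => z + (0, s))))
    ((hgs.sub hg).locallyIntegrableOn _) ?_
  intro φ hφ hφc hφO
  set I : ℝ → ℝ := fun τ => ∫ z, g z * φ (z - τ • ((0, s) : ℝ × ℝ)) with hI
  have hd := hasDerivAt_integral_mul_translate hg hφ hφc ((0, s) : ℝ × ℝ)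
  have hzero : ∀ τ ∈ Ico (0 : ℝ) 1,
      ∫ z, g z * fderiv ℝ φ (z - τ • ((0, s) : ℝ × ℝ)) (0, s) = 0 := by
    intro τ hτ
    have hφτ := h (fun z => φ (z - τ • ((0, s) : ℝ × ℝ))) (hφ.comp (contDiff_id.sub contDiff_const))
      (hφc.comp_homeomorph (Homeomorph.subRight _)) ?_
    · simp only [fderiv_comp_sub] at hφτ
      have : ((0, s) : ℝ × ℝ) = s • ((0, 1) : ℝ × ℝ) := by simp
      calc _ = ∫ z, s * (g z * fderiv ℝ φ (z - τ • ((0, s) : ℝ × ℝ)) (0, 1)) := by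
            refine integral_congr_ae (Eventually.of_forall fun z => ?_)
            simp only
            conv_lhs => rw [show fderiv ℝ φ (z - τ • ((0, s) : ℝ × ℝ)) (0, s)
              = s * fderiv ℝ φ (z - τ • ((0, s) : ℝ × ℝ)) (0, 1) by
                rw [← smul_eq_mul, ← map_smul, ← this]]
            ring
        _ = 0 := by rw [integral_const_mul, hφτ, mul_zero]
    · intro z hz
      have hz' : z - τ • ((0, s) : ℝ × ℝ) ∈ tsupport φ := by
        have := tsupport_comp_subset_preimage φ
          (by fun_prop : Continuous fun z : ℝ × ℝ => z - τ • ((0, s) : ℝ × ℝ))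
        exact this hz
      obtain ⟨h1, h2⟩ := hφO hz'
      obtain ⟨x, y⟩ := z
      simp only [Prod.smul_mk, smul_eq_mul, mul_zero, Prod.mk_sub_mk, sub_zero, mem_ofPred_eq,
        Prod.mk_add_mk, add_zero] at h1 h2
      refine hconv x _ _ h1 h2 y ?_
      rw [mem_uIcc]
      rcases le_total 0 s with hs | hs
      · left; constructor <;> nlinarith [hτ.1, hτ.2]
      · right; constructor <;> nlinarith [hτ.1, hτ.2]
  have hconst := constant_of_has_deriv_right_zero (f := I) (a := 0) (b := 1)
    (fun τ _ => (hd τ).continuousAt.continuousWithinAt)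
    (fun τ hτ => by
      have := (hd τ).hasDerivWithinAt (s := Ici τ)
      rwa [hzero τ hτ, neg_zero] at this) 1 (by simp)
  simp only [hI, one_smul, zero_smul, sub_zero] at hconst
  have hshift : ∫ z, g z * φ (z - ((0, s) : ℝ × ℝ)) = ∫ z, g (z + (0, s)) * φ z := by
    rw [← integral_add_right_eq_self _ ((0, s) : ℝ × ℝ)]
    simp
  have i1 : Integrable (fun z => φ z • g (z + (0, s))) :=
    hgs.integrable_smul_left_of_hasCompactSupport hφ.continuous hφc
  have i2 : Integrable (fun z => φ z • g z) :=
    hg.integrable_smul_left_of_hasCompactSupport hφ.continuous hφc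
  simp only [smul_sub]
  rw [integral_sub i1 i2, sub_eq_zero]
  simp only [smul_eq_mul, mul_comm (φ _)]
  rw [← hshift, hconst]

/-- Fubini on `{t ≤ y}`: the inner integral of `deriv b` over `[t, ∞)` is `-b t`. -/
theorem integral_primitive_mul_deriv {d b : ℝ → ℝ} (hd : Integrable d) (hb : ContDiff ℝ 1 b)
    (hbc : HasCompactSupport b) :
    ∫ y, (∫ t in Iic y, d t) * deriv b y = -∫ t, d t * b t := by
  have hbi : Integrable (deriv b) :=
    (hb.continuous_deriv le_rfl).integrable_of_hasCompactSupport hbc.deriv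
  have hS : MeasurableSet {z : ℝ × ℝ | z.2 ≤ z.1} := measurableSet_le measurable_snd measurable_fst
  have hint : Integrable (Function.uncurry fun y t : ℝ => (Iic y).indicator d t * deriv b y)
      (volume.prod volume) := by
    refine ((hbi.mul_prod hd).indicator hS).congr (Eventually.of_forall fun z => ?_)
    by_cases hz : z.2 ≤ z.1 <;> simp [indicator, hz, Function.uncurry, mul_comm]
  calc ∫ y, (∫ t in Iic y, d t) * deriv b y
      = ∫ y, ∫ t, (Iic y).indicator d t * deriv b y := by
        refine integral_congr_ae (Eventually.of_forall fun y => ?_)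
        simp only
        rw [integral_mul_const, integral_indicator measurableSet_Iic]
    _ = ∫ t, ∫ y, (Iic y).indicator d t * deriv b y := integral_integral_swap hint
    _ = ∫ t, d t * -b t := by
        refine integral_congr_ae (Eventually.of_forall fun t => ?_)
        simp only
        rw [← hbc.integral_Ioi_deriv_eq hb t, ← integral_const_mul, ← integral_Ici_eq_integral_Ioi,
          ← integral_indicator measurableSet_Ici]
        refine integral_congr_ae (Eventually.of_forall fun y => ?_)
        by_cases h : t ≤ y <;> simp [indicator, h]
    _ = _ := by simp [integral_neg]

theorem stronglyMeasurable_primitive {d : ℝ × ℝ → ℝ} (hd : StronglyMeasurable d) :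
    StronglyMeasurable fun z : ℝ × ℝ => ∫ t in Iic z.2, d (z.1, t) := by
  have h1 : StronglyMeasurable fun w : (ℝ × ℝ) × ℝ =>
      {w : (ℝ × ℝ) × ℝ | w.2 ≤ w.1.2}.indicator (fun w => d (w.1.1, w.2)) w :=
    (hd.comp_measurable (by fun_prop)).indicator
      (measurableSet_le (by fun_prop) (by fun_prop))
  have h2 := h1.integral_prod_right' (ν := volume)
  have h3 : (fun z : ℝ × ℝ => ∫ t in Iic z.2, d (z.1, t)) = fun z => ∫ t,
      {w : (ℝ × ℝ) × ℝ | w.2 ≤ w.1.2}.indicator (fun w => d (w.1.1, w.2)) (z, t) := by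
    funext z
    rw [← integral_indicator measurableSet_Iic]
    rfl
  rw [h3]
  exact h2

/-- The primitive is dominated by the integral of `‖d‖` over the whole vertical line, which is
integrable in `x`; hence it is integrable on horizontal bands of finite height. -/
theorem locallyIntegrable_primitive {d : ℝ × ℝ → ℝ} (hd : StronglyMeasurable d)
    (hdi : Integrable d) :
    LocallyIntegrable fun z : ℝ × ℝ => ∫ t in Iic z.2, d (z.1, t) := by
  intro z
  refine ⟨univ ×ˢ Ioo (z.2 - 1) (z.2 + 1), ?_, ?_⟩
  · exact prod_mem_nhds univ_mem (Ioo_mem_nhds (by linarith) (by linarith))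
  · have hN : Integrable (fun z : ℝ × ℝ => ∫ t, ‖d (z.1, t)‖)
        (volume.restrict (univ ×ˢ Ioo (z.2 - 1) (z.2 + 1))) := by
      rw [Measure.volume_eq_prod, ← Measure.prod_restrict, Measure.restrict_univ]
      rw [Measure.volume_eq_prod] at hdi
      exact hdi.integral_norm_prod_left.comp_fst _
    refine hN.mono' (stronglyMeasurable_primitive hd).aestronglyMeasurable ?_
    rw [Measure.volume_eq_prod] at hdi
    have h := hdi.prod_right_ae
    have h' : ∀ᵐ w : ℝ × ℝ, Integrable (fun y => d (w.1, y)) := by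
      rw [Measure.volume_eq_prod]
      exact Measure.quasiMeasurePreserving_fst.ae h
    filter_upwards [ae_restrict_of_ae h'] with w hw
    refine (norm_integral_le_integral_norm _).trans ?_
    exact setIntegral_le_integral hw.norm (Eventually.of_forall fun _ => norm_nonneg _)

theorem integral_primitive_mul_fderiv {d : ℝ × ℝ → ℝ} (hd : StronglyMeasurable d)
    (hdi : Integrable d) {φ : ℝ × ℝ → ℝ} (hφ : ContDiff ℝ ∞ φ) (hφc : HasCompactSupport φ) :
    ∫ z : ℝ × ℝ, (∫ t in Iic z.2, d (z.1, t)) * fderiv ℝ φ z (0, 1) = -∫ z, d z * φ z := by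
  have hfc : Continuous fun z => fderiv ℝ φ z (0, 1) :=
    (hφ.continuous_fderiv (by norm_num)).clm_apply continuous_const
  have i1 : Integrable fun z : ℝ × ℝ => (∫ t in Iic z.2, d (z.1, t)) * fderiv ℝ φ z (0, 1) :=
    (locallyIntegrable_primitive hd hdi).integrable_smul_right_of_hasCompactSupport hfc
      (hφc.fderiv_apply (𝕜 := ℝ) (0, 1))
  have i2 : Integrable fun z => d z * φ z :=
    hdi.locallyIntegrable.integrable_smul_right_of_hasCompactSupport hφ.continuous hφc
  rw [Measure.volume_eq_prod] at i1 i2 ⊢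
  rw [integral_prod _ i1, integral_prod _ i2, ← integral_neg]
  rw [Measure.volume_eq_prod] at hdi
  refine integral_congr_ae ?_
  filter_upwards [hdi.prod_right_ae] with x hx
  have hline : ContDiff ℝ ∞ fun y => φ (x, y) := hφ.comp (contDiff_const.prodMk contDiff_id)
  have hcs : HasCompactSupport fun y => φ (x, y) :=
    hφc.comp_isClosedEmbedding ⟨isEmbedding_prodMkRight x, by
      rw [show range (Prod.mk x) = ({x} : Set ℝ) ×ˢ (univ : Set ℝ) by ext ⟨a, b⟩; simp [eq_comm]]
      exact isClosed_singleton.prod isClosed_univ⟩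
  rw [← integral_primitive_mul_deriv hx (hline.of_le (by norm_num)) hcs]
  refine integral_congr_ae (Eventually.of_forall fun y => ?_)
  simp only
  congr 1
  have h1 : HasFDerivAt φ (fderiv ℝ φ (x, y)) (x, y) :=
    (hφ.differentiable (by norm_num) _).hasFDerivAt
  have h2 : HasDerivAt (fun y : ℝ => ((x, y) : ℝ × ℝ)) (0, 1) y :=
    (hasDerivAt_const y x).prodMk (hasDerivAt_id y)
  exact (h1.comp_hasDerivAt y h2).deriv.symm

/-- Hölder's inequality against the constant `1` on the interval between `y'` and `y`. -/
theorem enorm_primitive_sub_rpow_le {p : ℝ} (hp : 1 < p) {d : ℝ → ℝ} (hd : Integrable d)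
    (y y' : ℝ) :
    ‖(∫ t in Iic y, d t) - ∫ t in Iic y', d t‖ₑ ^ p ≤
      ENNReal.ofReal |y - y'| ^ (p - 1) * ∫⁻ t, ‖d t‖ₑ ^ p := by
  have hq := Real.HolderConjugate.conjExponent hp
  set q := p.conjExponent
  have hp0 : 0 < p := by linarith
  rw [intervalIntegral.integral_Iic_sub_Iic hd.integrableOn hd.integrableOn]
  have h1 : ‖∫ t in y'..y, d t‖ₑ ≤ ∫⁻ t in uIoc y' y, ‖d t‖ₑ := by
    rw [← enorm_norm, intervalIntegral.norm_intervalIntegral_eq, enorm_norm]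
    exact enorm_integral_le_lintegral_enorm _
  have h2 := ENNReal.lintegral_mul_le_Lp_mul_Lq (volume.restrict (uIoc y' y)) hq
    (f := fun t => ‖d t‖ₑ) (g := fun _ => 1) hd.aestronglyMeasurable.enorm.restrict
    aemeasurable_const
  simp only [Pi.mul_def, mul_one, ENNReal.one_rpow, lintegral_const, one_mul,
    Measure.restrict_apply_univ] at h2
  calc _ ≤ ((∫⁻ t in uIoc y' y, ‖d t‖ₑ ^ p) ^ (1 / p) * volume (uIoc y' y) ^ (1 / q)) ^ p := by
        gcongr; exact h1.trans h2
    _ = (∫⁻ t in uIoc y' y, ‖d t‖ₑ ^ p) * ENNReal.ofReal |y - y'| ^ (p - 1) := by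
        rw [ENNReal.mul_rpow_of_nonneg _ _ hp0.le, ← ENNReal.rpow_mul, ← ENNReal.rpow_mul,
          one_div_mul_cancel hp0.ne', ENNReal.rpow_one, Real.volume_uIoc]
        congr 2
        have := hq.sub_one_mul_conj
        have := hq.symm.pos
        field_simp
        linarith
    _ ≤ _ := by
        rw [mul_comm]
        gcongr
        exact Measure.restrict_le_self

/-- An integrable function with an integrable weak derivative in the vertical direction coincides,
on almost every vertical line, with a Hölder continuous function. -/
theorem ae_exists_holder_representative {p : ℝ} (hp : 1 < p) {O : Set (ℝ × ℝ)} (hO : IsOpen O)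
    (hconv : VerticallyConvex O) {v d : ℝ × ℝ → ℝ} (hvm : StronglyMeasurable v)
    (hv : Integrable v) (hdm : StronglyMeasurable d) (hd : Integrable d)
    (h : ∀ φ : ℝ × ℝ → ℝ, ContDiff ℝ ∞ φ → HasCompactSupport φ → tsupport φ ⊆ O →
      ∫ z, v z * fderiv ℝ φ z (0, 1) = -∫ z, d z * φ z) :
    ∀ᵐ x : ℝ, ∃ F : ℝ → ℝ, (∀ᵐ y : ℝ, (x, y) ∈ O → v (x, y) = F y) ∧
      ∀ y y' : ℝ, ‖F y - F y'‖ₑ ^ p ≤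
        ENNReal.ofReal |y - y'| ^ (p - 1) * ∫⁻ t, ‖d (x, t)‖ₑ ^ p := by
  set W : ℝ × ℝ → ℝ := fun z => ∫ t in Iic z.2, d (z.1, t) with hW
  set g : ℝ × ℝ → ℝ := fun z => v z - W z with hg
  have hWm : StronglyMeasurable W := stronglyMeasurable_primitive hdm
  -- `W` has weak vertical derivative `d` in the whole plane, so `g = v - W` has none in `O` and is
  -- invariant under vertical translations.
  have hWl : LocallyIntegrable W := locallyIntegrable_primitive hdm hd
  have hgm : StronglyMeasurable g := hvm.sub hWm
  have hgl : LocallyIntegrable g := hv.locallyIntegrable.sub hWl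
  have hg0 : ∀ φ : ℝ × ℝ → ℝ, ContDiff ℝ ∞ φ → HasCompactSupport φ → tsupport φ ⊆ O →
      ∫ z, g z * fderiv ℝ φ z (0, 1) = 0 := by
    intro φ hφ hφc hφO
    have hfc : Continuous fun z => fderiv ℝ φ z (0, 1) :=
      (hφ.continuous_fderiv (by norm_num)).clm_apply continuous_const
    have hfs := hφc.fderiv_apply (𝕜 := ℝ) (0, 1)
    simp only [hg, sub_mul]
    have i1 : Integrable fun z => v z * fderiv ℝ φ z (0, 1) :=
      hv.locallyIntegrable.integrable_smul_right_of_hasCompactSupport hfc hfs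
    have i2 : Integrable fun z => W z * fderiv ℝ φ z (0, 1) :=
      hWl.integrable_smul_right_of_hasCompactSupport hfc hfs
    rw [integral_sub i1 i2, h φ hφ hφc hφO,
      integral_primitive_mul_fderiv hdm hd hφ hφc, sub_self]
  have hinv := ae_translate_eq_of_weak_deriv_eq_zero hO hconv hgl hg0
  have hmeas : MeasurableSet {w : ℝ × (ℝ × ℝ) | w.2 ∈ O ∩ {z | z + (0, w.1) ∈ O} →
      g (w.2 + (0, w.1)) - g w.2 = 0} := by
    have m1 : MeasurableSet {w : ℝ × (ℝ × ℝ) | w.2 ∈ O ∩ {z | z + (0, w.1) ∈ O}} := by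
      refine MeasurableSet.inter ?_ ?_
      · exact hO.measurableSet.preimage measurable_snd
      · exact hO.measurableSet.preimage
          (by fun_prop : Measurable fun w : ℝ × (ℝ × ℝ) => w.2 + (0, w.1))
    have m2 : MeasurableSet {w : ℝ × (ℝ × ℝ) | g (w.2 + (0, w.1)) - g w.2 = 0} := by
      have : Measurable fun w : ℝ × (ℝ × ℝ) => g (w.2 + (0, w.1)) - g w.2 :=
        (hgm.measurable.comp (by fun_prop)).sub (hgm.measurable.comp measurable_snd)
      exact this (measurableSet_singleton 0)
    convert m1.compl.union m2 using 1
    ext w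
    simp [imp_iff_not_or]
  -- Invariance holds for each shift outside a null set depending on the shift; Fubini exchanges the
  -- quantifiers, so that one base point can serve almost all shifts.
  have hswap : ∀ᵐ z : ℝ × ℝ, ∀ᵐ s : ℝ, z ∈ O ∩ {z | z + (0, s) ∈ O} →
      g (z + (0, s)) - g z = 0 :=
    (Measure.ae_ae_comm (μ := (volume : Measure ℝ)) (ν := (volume : Measure (ℝ × ℝ)))
      (p := fun s z => z ∈ O ∩ {z | z + (0, s) ∈ O} → g (z + (0, s)) - g z = 0) hmeas).1
      (Eventually.of_forall hinv)
  rw [Measure.volume_eq_prod] at hswap hd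
  filter_upwards [Measure.ae_ae_of_ae_prod hswap, hd.prod_right_ae] with x hx hdx
  by_cases hempty : ∀ᵐ y : ℝ, (x, y) ∉ O
  · refine ⟨fun y => 0, ?_, ?_⟩
    · filter_upwards [hempty] with y hy hy'
      exact absurd hy' hy
    · intro y y'
      simp [ENNReal.zero_rpow_of_pos (by linarith : 0 < p)]
  -- A base point on the line from which almost every shift inside `O` preserves `g`: there `v` is
  -- `W` plus the constant `g (x, y₀)`.
  · obtain ⟨y₀, hy₀, hy₀'⟩ := (Frequently.and_eventually hempty hx).exists
    refine ⟨fun y => g (x, y₀) + W (x, y), ?_, ?_⟩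
    · have := (measurePreserving_sub_right (volume : Measure ℝ) y₀).quasiMeasurePreserving.ae hy₀'
      filter_upwards [this] with y hy hyO
      have e : ((x, y₀) : ℝ × ℝ) + (0, y - y₀) = (x, y) := by simp
      simp only [mem_inter_iff, mem_ofPred_eq, e] at hy
      have := hy ⟨hy₀, hyO⟩
      simp only [hg] at this ⊢
      linarith
    · intro y y'
      rw [add_sub_add_left_eq_sub]
      exact enorm_primitive_sub_rpow_le hp hdx y y'

/-! ### Subgraphs, stretching and thin strips. -/

/-- The region over `(0, 1)` between the horizontal axis and the graph of `h`. -/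
def subgraph (h : ℝ → ℝ) : Set (ℝ × ℝ) :=
  {z | z.1 ∈ Ioo (0 : ℝ) 1 ∧ 0 < z.2 ∧ z.2 < h z.1}

/-- `h` is continuous on `(0, 1)` except at finitely many points. -/
def ContinuousOffFinite (h : ℝ → ℝ) : Prop :=
  ∃ F : Set ℝ, F.Finite ∧ ContinuousOn h (Ioo 0 1 \ F)

theorem isOpen_subgraph_diff {h : ℝ → ℝ} {F : Set ℝ} (hF : F.Finite)
    (hc : ContinuousOn h (Ioo 0 1 \ F)) : IsOpen (subgraph h \ F ×ˢ univ) := by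
  have hA : IsOpen (Ioo (0 : ℝ) 1 \ F) := isOpen_Ioo.sdiff hF.isClosed
  have hc' : ContinuousOn (fun z : ℝ × ℝ => h z.1 - z.2) ((Ioo (0 : ℝ) 1 \ F) ×ˢ Ioi 0) :=
    (hc.comp continuousOn_fst fun z hz => hz.1).sub continuousOn_snd
  have := hc'.isOpen_inter_preimage (hA.prod isOpen_Ioi) isOpen_Ioi (t := Ioi 0)
  convert this using 1
  ext z
  simp [subgraph]
  tauto

theorem measurableSet_subgraph {h : ℝ → ℝ} (hh : ContinuousOffFinite h) :
    MeasurableSet (subgraph h) := by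
  obtain ⟨F, hF, hc⟩ := hh
  have h1 := (isOpen_subgraph_diff hF hc).measurableSet
  have h2 : MeasurableSet (⋃ x ∈ F ∩ Ioo 0 1, ({x} : Set ℝ) ×ˢ Ioo 0 (h x)) :=
    (hF.subset inter_subset_left).measurableSet_biUnion fun x _ =>
      (measurableSet_singleton x).prod measurableSet_Ioo
  convert h1.union h2 using 1
  ext ⟨x, y⟩
  simp [subgraph]
  tauto

theorem volume_subgraph_lt_top {h : ℝ → ℝ} {b : ℝ} (hb : ∀ x ∈ Ioo (0 : ℝ) 1, h x ≤ b) :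
    volume (subgraph h) < ⊤ := by
  have : subgraph h ⊆ Ioo 0 1 ×ˢ Ioo 0 b := fun z hz =>
    ⟨hz.1, hz.2.1, hz.2.2.trans_le (hb _ hz.1)⟩
  refine (measure_mono this).trans_lt ?_
  rw [Measure.volume_eq_prod, Measure.prod_prod]
  simp

theorem verticallyConvex_subgraph_diff (h : ℝ → ℝ) (F : Set ℝ) :
    VerticallyConvex (subgraph h \ F ×ˢ univ) := by
  rintro x y y' ⟨⟨h1, h2, h3⟩, h4⟩ ⟨⟨-, h2', h3'⟩, -⟩ t ht
  rw [mem_uIcc] at ht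
  simp only at h2 h3 h2' h3'
  refine ⟨⟨h1, ?_, ?_⟩, by simpa using h4⟩ <;> simp only <;> rcases ht with ht | ht <;>
    linarith [ht.1, ht.2]

/-- A subgraph may fail to be open above the discontinuities of `h`. Removing these finitely many
vertical lines leaves an open, vertically convex set, and almost every `x` avoids them. Extending
measurable representatives by zero reduces to the planar statement. -/
theorem MemSobolev.ae_exists_holder_representative {p : ℝ} (hp : 1 < p) {h : ℝ → ℝ}
    (hh : ContinuousOffFinite h) {b : ℝ} (hb : ∀ x ∈ Ioo (0 : ℝ) 1, h x ≤ b)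
    {w : ℝ × ℝ → ℝ} {Dw : ℝ × ℝ → Vec} (hw : MemSobolev p (subgraph h) w Dw) :
    ∀ᵐ x : ℝ, ∃ F : ℝ → ℝ, (∀ᵐ y : ℝ, (x, y) ∈ subgraph h → w (x, y) = F y) ∧
      ∀ y y' : ℝ, ‖F y - F y'‖ₑ ^ p ≤ ENNReal.ofReal |y - y'| ^ (p - 1) *
        ∫⁻ t, (subgraph h).indicator (fun z => ‖Dw z‖ₑ ^ p) (x, t) := by
  obtain ⟨F, hF, hc⟩ := id hh
  have hUm := measurableSet_subgraph hh
  set U := subgraph h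
  have : IsFiniteMeasure (volume.restrict U) := ⟨by simpa using volume_subgraph_lt_top hb⟩
  have hp1 : 1 ≤ ENNReal.ofReal p := by simpa using hp.le
  have hwi : Integrable w (volume.restrict U) := hw.memLp.integrable hp1
  have hDi : Integrable (fun z => Dw z 1) (volume.restrict U) :=
    ((EuclideanSpace.proj (1 : Fin 2) : Vec →L[ℝ] ℝ).integrable_comp (hw.memLp_grad.integrable hp1))
  set v₀ := hwi.aestronglyMeasurable.mk w
  set d₀ := hDi.aestronglyMeasurable.mk (fun z => Dw z 1)
  have hv₀ : w =ᵐ[volume.restrict U] v₀ := hwi.aestronglyMeasurable.ae_eq_mk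
  have hd₀ : (fun z => Dw z 1) =ᵐ[volume.restrict U] d₀ := hDi.aestronglyMeasurable.ae_eq_mk
  have key := ThinDomain.ae_exists_holder_representative hp (isOpen_subgraph_diff hF hc)
    (verticallyConvex_subgraph_diff h F) (v := U.indicator v₀) (d := U.indicator d₀)
    (hwi.aestronglyMeasurable.stronglyMeasurable_mk.indicator hUm)
    ((integrable_indicator_iff hUm).2 (hwi.congr hv₀))
    (hDi.aestronglyMeasurable.stronglyMeasurable_mk.indicator hUm)
    ((integrable_indicator_iff hUm).2 (hDi.congr hd₀)) ?_
  · have e1 : ∀ᵐ z : ℝ × ℝ, z ∈ U → w z = v₀ z := (ae_restrict_iff' hUm).1 hv₀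
    have e2 : ∀ᵐ z : ℝ × ℝ, z ∈ U → Dw z 1 = d₀ z := (ae_restrict_iff' hUm).1 hd₀
    have e3 : ∀ᵐ x : ℝ, x ∉ F := measure_eq_zero_iff_ae_notMem.1 (hF.measure_zero volume)
    rw [Measure.volume_eq_prod] at e1 e2
    filter_upwards [key, Measure.ae_ae_of_ae_prod e1, Measure.ae_ae_of_ae_prod e2, e3] with
      x ⟨f, hf1, hf2⟩ hx1 hx2 hx3
    refine ⟨f, ?_, ?_⟩
    · filter_upwards [hf1, hx1] with y h1 h2 hy
      rw [h2 hy, ← h1 ⟨hy, by simp [hx3]⟩, indicator_of_mem hy]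
    · intro y y'
      refine (hf2 y y').trans ?_
      refine mul_le_mul_right (lintegral_mono_ae ?_) _
      filter_upwards [hx2] with t ht
      by_cases hm : (x, t) ∈ U
      · rw [indicator_of_mem hm, indicator_of_mem hm, ← ht hm]
        gcongr
        rw [enorm_le_iff_norm_le]
        exact PiLp.norm_apply_le _ _
      · simp [hm, ENNReal.zero_rpow_of_pos (by linarith : 0 < p)]
  · intro φ hφ hφc hφO
    have hwg := (hw.weakGradient φ hφ hφc (hφO.trans sdiff_subset)).2
    have i1 : ∫ z, U.indicator v₀ z * fderiv ℝ φ z (0, 1) = ∫ z in U, w z * fderiv ℝ φ z (0, 1) := by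
      rw [← integral_indicator hUm]
      refine integral_congr_ae ?_
      filter_upwards [(ae_restrict_iff' hUm).1 hv₀] with z hz
      by_cases hm : z ∈ U
      · simp [hm, hz hm]
      · simp [hm]
    have i2 : ∫ z, U.indicator d₀ z * φ z = ∫ z in U, Dw z 1 * φ z := by
      rw [← integral_indicator hUm]
      refine integral_congr_ae ?_
      filter_upwards [(ae_restrict_iff' hUm).1 hd₀] with z hz
      by_cases hm : z ∈ U
      · simp [hm, hz hm]
      · simp [hm]
    rw [i1, i2, hwg]

theorem lintegral_restrict_eq_lintegral_lintegral {U : Set (ℝ × ℝ)} (hU : MeasurableSet U)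
    {f : ℝ × ℝ → ℝ≥0∞} (hf : AEMeasurable f (volume.restrict U)) :
    ∫⁻ z in U, f z = ∫⁻ x, ∫⁻ y, U.indicator f (x, y) := by
  rw [← lintegral_indicator hU, Measure.volume_eq_prod, lintegral_prod]
  rw [← Measure.volume_eq_prod]
  exact (aemeasurable_indicator_iff hU).2 hf

/-- On each line the Hölder bound applies to `y` and `y / k`, whose distance `(y / k)(k - 1)` is at
most `b (k - 1)`; integrating over a fibre of length at most `b` gives the remaining factor. -/
theorem MemSobolev.lintegral_sub_stretch_le {p : ℝ} (hp : 1 < p) {h : ℝ → ℝ}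
    (hh : ContinuousOffFinite h) {b : ℝ} (hb : ∀ x ∈ Ioo (0 : ℝ) 1, h x ≤ b)
    {w : ℝ × ℝ → ℝ} {Dw : ℝ × ℝ → Vec} (hw : MemSobolev p (subgraph h) w Dw)
    {k : ℝ} (hk : 1 ≤ k) :
    ∫⁻ z in subgraph h, ‖w z - w (z.1, z.2 / k)‖ₑ ^ p ≤
      ENNReal.ofReal b * ENNReal.ofReal (b * (k - 1)) ^ (p - 1) *
        ∫⁻ z in subgraph h, ‖Dw z‖ₑ ^ p := by
  have hUm := measurableSet_subgraph hh
  have hp0 : 0 < p := by linarith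
  have hk0 : 0 < k := by linarith
  have hDm : AEMeasurable (fun z => ‖Dw z‖ₑ ^ p) (volume.restrict (subgraph h)) :=
    hw.memLp_grad.aestronglyMeasurable.enorm.pow_const p
  rw [lintegral_restrict_eq_lintegral_lintegral hUm hDm, ← lintegral_indicator hUm,
    ← lintegral_const_mul' _ _ (by finiteness), Measure.volume_eq_prod]
  refine (lintegral_prod_le _).trans (lintegral_mono_ae ?_)
  filter_upwards [hw.ae_exists_holder_representative hp hh hb] with x ⟨F, hF1, hF2⟩
  by_cases hx : x ∈ Ioo (0 : ℝ) 1
  swap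
  · have : ∀ y, (x, y) ∉ subgraph h := fun y hy => hx hy.1
    simp [this]
  -- `F` agrees with `w` only almost everywhere, so evaluating at `y / k` requires that this map
  -- pulls null sets back to null sets.
  have hq : Measure.QuasiMeasurePreserving (fun y : ℝ => k⁻¹ * y) := by
    refine ⟨by fun_prop, ?_⟩
    rw [Real.map_volume_mul_left (by positivity)]
    exact Measure.smul_absolutelyContinuous
  set D := ∫⁻ t, (subgraph h).indicator (fun z => ‖Dw z‖ₑ ^ p) (x, t)
  calc ∫⁻ y, (subgraph h).indicator (fun z => ‖w z - w (z.1, z.2 / k)‖ₑ ^ p) (x, y)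
      ≤ ∫⁻ y, (Ioo 0 b).indicator (fun _ => ENNReal.ofReal (b * (k - 1)) ^ (p - 1) * D) y := by
        refine lintegral_mono_ae ?_
        filter_upwards [hF1, hq.ae hF1] with y h1 h2
        by_cases hm : (x, y) ∈ subgraph h
        · have hy0 : 0 < y := hm.2.1
          have hyh : y < h x := hm.2.2
          have hyb : y < b := hyh.trans_le (hb x hx)
          have hyk : y / k ≤ y := div_le_self hy0.le hk
          have hm' : (x, k⁻¹ * y) ∈ subgraph h := by
            refine ⟨hx, by positivity, ?_⟩
            simp only [inv_mul_eq_div]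
            linarith
          rw [indicator_of_mem hm, indicator_of_mem (show y ∈ Ioo 0 b from ⟨hy0, hyb⟩)]
          simp only
          rw [h1 hm, ← inv_mul_eq_div, h2 hm']
          refine (hF2 _ _).trans ?_
          gcongr
          · rw [inv_mul_eq_div, abs_of_nonneg (by linarith)]
            have : y - y / k = y / k * (k - 1) := by field_simp
            rw [this]
            gcongr
            linarith
        · rw [indicator_of_notMem hm]
          exact zero_le
    _ = _ := by
        rw [lintegral_indicator measurableSet_Ioo, setLIntegral_const, Real.volume_Ioo, sub_zero]
        ring

/-- A one-dimensional Sobolev embedding on each fibre bounds the representative pointwise;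
integrating over a strip of height at most `c` produces the small factor. The lower bound `a` on the
fibre length enters when averaging. -/
theorem MemSobolev.lintegral_strip_le {p : ℝ} (hp : 1 < p) {h h' : ℝ → ℝ}
    (hh : ContinuousOffFinite h) (hh' : ContinuousOffFinite h') {a b c : ℝ}
    (ha : ∀ x ∈ Ioo (0 : ℝ) 1, a ≤ h x) (hb : ∀ x ∈ Ioo (0 : ℝ) 1, h x ≤ b)
    (hc : ∀ x ∈ Ioo (0 : ℝ) 1, h x - h' x ≤ c)
    {w : ℝ × ℝ → ℝ} {Dw : ℝ × ℝ → Vec} (hw : MemSobolev p (subgraph h) w Dw) :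
    ENNReal.ofReal a * ∫⁻ z in subgraph h \ subgraph h', ‖w z‖ₑ ^ p ≤
      ENNReal.ofReal c * (2 ^ (p - 1) * ((∫⁻ z in subgraph h, ‖w z‖ₑ ^ p) +
        ENNReal.ofReal b ^ p * ∫⁻ z in subgraph h, ‖Dw z‖ₑ ^ p)) := by
  have hUm := measurableSet_subgraph hh
  have hSm := hUm.diff (measurableSet_subgraph hh')
  have hp0 : 0 < p := by linarith
  have hwm : AEMeasurable (fun z => ‖w z‖ₑ ^ p) (volume.restrict (subgraph h)) :=
    hw.memLp.aestronglyMeasurable.enorm.pow_const p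
  have hDm : AEMeasurable (fun z => ‖Dw z‖ₑ ^ p) (volume.restrict (subgraph h)) :=
    hw.memLp_grad.aestronglyMeasurable.enorm.pow_const p
  have hwm' : AEMeasurable (fun x => ∫⁻ y, (subgraph h).indicator (fun z => ‖w z‖ₑ ^ p) (x, y)) :=
    AEMeasurable.lintegral_prod_right' (by
      rw [← Measure.volume_eq_prod]; exact (aemeasurable_indicator_iff hUm).2 hwm)
  have h2fin : (2 : ℝ≥0∞) ^ (p - 1) ≠ ⊤ := by finiteness
  rw [lintegral_restrict_eq_lintegral_lintegral hUm hDm,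
    lintegral_restrict_eq_lintegral_lintegral hUm hwm,
    lintegral_restrict_eq_lintegral_lintegral hSm (hwm.mono_measure
      (Measure.restrict_mono sdiff_subset le_rfl)),
    ← lintegral_const_mul' _ _ (by finiteness), ← lintegral_const_mul' _ _ (by finiteness),
    ← lintegral_add_left' hwm', ← lintegral_const_mul' _ _ h2fin,
    ← lintegral_const_mul' _ _ (by finiteness)]
  refine lintegral_mono_ae ?_
  filter_upwards [hw.ae_exists_holder_representative hp hh hb] with x ⟨F, hF1, hF2⟩
  by_cases hx : x ∈ Ioo (0 : ℝ) 1
  swap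
  · have : ∀ y, (x, y) ∉ subgraph h := fun y hy => hx hy.1
    simp [this]
  set D := ∫⁻ t, (subgraph h).indicator (fun z => ‖Dw z‖ₑ ^ p) (x, t)
  set N := ∫⁻ t, (subgraph h).indicator (fun z => ‖w z‖ₑ ^ p) (x, t) with hN
  have hsec : ∀ y, (x, y) ∈ subgraph h ↔ y ∈ Ioo 0 (h x) := fun y =>
    ⟨fun hy => hy.2, fun hy => ⟨hx, hy⟩⟩
  have hNF : N = ∫⁻ y in Ioo 0 (h x), ‖F y‖ₑ ^ p := by
    rw [hN, ← lintegral_indicator measurableSet_Ioo]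
    refine lintegral_congr_ae ?_
    filter_upwards [hF1] with y hy
    by_cases hm : (x, y) ∈ subgraph h
    · rw [indicator_of_mem hm, indicator_of_mem ((hsec y).1 hm), hy hm]
    · rw [indicator_of_notMem hm, indicator_of_notMem (fun h' => hm ((hsec y).2 h'))]
  have hpt : ∀ y ∈ Ioo 0 (h x), ENNReal.ofReal a * ‖F y‖ₑ ^ p ≤
      2 ^ (p - 1) * (N + ENNReal.ofReal b ^ p * D) := by
    intro y hy
    have hhb := hb x hx
    calc ENNReal.ofReal a * ‖F y‖ₑ ^ p ≤ ENNReal.ofReal (h x) * ‖F y‖ₑ ^ p := by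
          gcongr; exact ha x hx
      _ = ∫⁻ _ in Ioo 0 (h x), ‖F y‖ₑ ^ p := by
          rw [setLIntegral_const, Real.volume_Ioo, sub_zero, mul_comm]
      -- The value at `y` is compared with the value at every `y'` of the fibre, and `y'` is
      -- averaged out.
      _ ≤ ∫⁻ y' in Ioo 0 (h x), 2 ^ (p - 1) * (‖F y'‖ₑ ^ p + ENNReal.ofReal b ^ (p - 1) * D) := by
          refine setLIntegral_mono' measurableSet_Ioo fun y' hy' => ?_
          calc ‖F y‖ₑ ^ p = ‖F y' + (F y - F y')‖ₑ ^ p := by rw [add_sub_cancel]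
            _ ≤ (‖F y'‖ₑ + ‖F y - F y'‖ₑ) ^ p := by gcongr; exact enorm_add_le _ _
            _ ≤ 2 ^ (p - 1) * (‖F y'‖ₑ ^ p + ‖F y - F y'‖ₑ ^ p) :=
                ENNReal.rpow_add_le_mul_rpow_add_rpow _ _ hp.le
            _ ≤ _ := by
                gcongr
                refine (hF2 y y').trans ?_
                gcongr
                · rw [abs_le]; constructor <;> linarith [hy.1, hy.2, hy'.1, hy'.2]
      _ = 2 ^ (p - 1) * (N + ENNReal.ofReal (h x) * (ENNReal.ofReal b ^ (p - 1) * D)) := by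
          rw [lintegral_const_mul' _ _ h2fin, lintegral_add_right _ measurable_const,
            setLIntegral_const, Real.volume_Ioo, sub_zero, hNF, mul_comm (ENNReal.ofReal (h x))]
      _ ≤ 2 ^ (p - 1) * (N + ENNReal.ofReal b ^ p * D) := by
          have : ENNReal.ofReal b ^ p = ENNReal.ofReal b * ENNReal.ofReal b ^ (p - 1) := by
            have := ENNReal.rpow_add_of_nonneg (x := ENNReal.ofReal b) 1 (p - 1) zero_le_one
              (by linarith)
            rwa [add_sub_cancel, ENNReal.rpow_one] at this
          rw [this, mul_assoc]
          gcongr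
  rw [← lintegral_const_mul' _ _ (by finiteness)]
  calc _ ≤ ∫⁻ y, (Ico (h' x) (h x)).indicator
        (fun _ => 2 ^ (p - 1) * (N + ENNReal.ofReal b ^ p * D)) y := by
        refine lintegral_mono_ae ?_
        filter_upwards [hF1] with y hy
        by_cases hm : (x, y) ∈ subgraph h \ subgraph h'
        · have hy' := (hsec y).1 hm.1
          rw [indicator_of_mem hm, indicator_of_mem, hy hm.1]
          · exact hpt y hy'
          · refine ⟨?_, hy'.2⟩
            by_contra hlt
            exact hm.2 ⟨hx, hy'.1, not_le.1 hlt⟩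
        · rw [indicator_of_notMem hm, mul_zero]
          exact zero_le
    _ = ENNReal.ofReal (h x - h' x) * (2 ^ (p - 1) * (N + ENNReal.ofReal b ^ p * D)) := by
        rw [lintegral_indicator measurableSet_Ico, setLIntegral_const, Real.volume_Ico, mul_comm]
    _ ≤ _ := by gcongr; exact hc x hx

/-! ### Sobolev functions under restriction, linear operations and vertical contraction. -/

theorem MemSobolev.mono {p : ℝ} {U V : Set (ℝ × ℝ)} {u : ℝ × ℝ → ℝ} {Du : ℝ × ℝ → Vec}
    (hu : MemSobolev p V u Du) (hV : MeasurableSet V) (hUV : U ⊆ V) :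
    MemSobolev p U u Du where
  memLp := hu.memLp.mono_measure (Measure.restrict_mono hUV le_rfl)
  memLp_grad := hu.memLp_grad.mono_measure (Measure.restrict_mono hUV le_rfl)
  weakGradient := by
    intro φ hφ hφc hφU
    have h0 : ∀ z, z ∉ U → φ z = 0 := fun z hz => image_eq_zero_of_notMem_tsupport (mt (@hφU z) hz)
    have h1 : ∀ z, z ∉ U → fderiv ℝ φ z = 0 := fun z hz =>
      image_eq_zero_of_notMem_tsupport (mt (fun h => hφU (tsupport_fderiv_subset ℝ h)) hz)
    have key : ∀ f : ℝ × ℝ → ℝ, (∀ z, z ∉ U → f z = 0) → ∫ z in U, f z = ∫ z in V, f z := by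
      intro f hf
      exact (setIntegral_eq_of_subset_of_forall_sdiff_eq_zero hV hUV fun z hz => hf z hz.2).symm
    obtain ⟨a, b⟩ := hu.weakGradient φ hφ hφc (hφU.trans hUV)
    refine ⟨?_, ?_⟩
    · rw [key _ fun z hz => by simp [h1 z hz], key _ fun z hz => by simp [h0 z hz], a]
    · rw [key _ fun z hz => by simp [h1 z hz], key _ fun z hz => by simp [h0 z hz], b]

theorem integrable_mul_of_hasCompactSupport {p : ℝ} (hp : 1 ≤ p) {U : Set (ℝ × ℝ)}
    {u φ : ℝ × ℝ → ℝ} (hu : MemLp u (ENNReal.ofReal p) (volume.restrict U)) (hφ : Continuous φ)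
    (hφc : HasCompactSupport φ) : Integrable (fun z => u z * φ z) (volume.restrict U) :=
  (hu.locallyIntegrable (by simpa using hp)).integrable_smul_right_of_hasCompactSupport hφ hφc

theorem MemLp.grad_apply {p : ℝ≥0∞} {μ : Measure (ℝ × ℝ)} {Du : ℝ × ℝ → Vec} (hu : MemLp Du p μ)
    (i : Fin 2) : MemLp (fun z => Du z i) p μ :=
  (EuclideanSpace.proj i : Vec →L[ℝ] ℝ).comp_memLp' hu

theorem MemSobolev.add {p : ℝ} (hp : 1 ≤ p) {U : Set (ℝ × ℝ)} {u v : ℝ × ℝ → ℝ}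
    {Du Dv : ℝ × ℝ → Vec} (hu : MemSobolev p U u Du) (hv : MemSobolev p U v Dv) :
    MemSobolev p U (fun z => u z + v z) (fun z => Du z + Dv z) where
  memLp := hu.memLp.add hv.memLp
  memLp_grad := hu.memLp_grad.add hv.memLp_grad
  weakGradient := by
    intro φ hφ hφc hφU
    have hf : ∀ e, Continuous fun z => fderiv ℝ φ z e := fun e =>
      (hφ.continuous_fderiv (by norm_num)).clm_apply continuous_const
    have hfs : ∀ e, HasCompactSupport fun z => fderiv ℝ φ z e := fun e =>
      hφc.fderiv_apply (𝕜 := ℝ) e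
    obtain ⟨a, b⟩ := hu.weakGradient φ hφ hφc hφU
    obtain ⟨a', b'⟩ := hv.weakGradient φ hφ hφc hφU
    have key : ∀ e i, ∫ z in U, u z * fderiv ℝ φ z e = -∫ z in U, Du z i * φ z →
        ∫ z in U, v z * fderiv ℝ φ z e = -∫ z in U, Dv z i * φ z →
        ∫ z in U, (u z + v z) * fderiv ℝ φ z e = -∫ z in U, (Du z + Dv z) i * φ z := by
      intro e i h1 h2
      simp only [PiLp.add_apply, add_mul]
      rw [integral_add (integrable_mul_of_hasCompactSupport hp hu.memLp (hf e) (hfs e))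
        (integrable_mul_of_hasCompactSupport hp hv.memLp (hf e) (hfs e)),
        integral_add (integrable_mul_of_hasCompactSupport hp (MemLp.grad_apply hu.memLp_grad i)
          hφ.continuous hφc)
        (integrable_mul_of_hasCompactSupport hp (MemLp.grad_apply hv.memLp_grad i)
          hφ.continuous hφc), h1, h2]
      ring
    exact ⟨key _ _ a a', key _ _ b b'⟩

theorem MemSobolev.const_mul {p : ℝ} {U : Set (ℝ × ℝ)} {u : ℝ × ℝ → ℝ}
    {Du : ℝ × ℝ → Vec} (hu : MemSobolev p U u Du) (c : ℝ) :
    MemSobolev p U (fun z => c * u z) (fun z => c • Du z) where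
  memLp := hu.memLp.const_mul c
  memLp_grad := hu.memLp_grad.const_smul c
  weakGradient := by
    intro φ hφ hφc hφU
    obtain ⟨a, b⟩ := hu.weakGradient φ hφ hφc hφU
    simp only [PiLp.smul_apply, smul_eq_mul, mul_assoc]
    simp only [integral_const_mul, a, b, mul_neg, and_self]

/-- The vertical contraction `(x, y) ↦ (x, y / k)`. -/
noncomputable def contract (k : ℝ) (z : ℝ × ℝ) : ℝ × ℝ := (z.1, z.2 / k)

/-- The gradient of `v ∘ contract k` at a point whose image has gradient `a`. -/
noncomputable def contractGrad (k : ℝ) : Vec →L[ℝ] Vec :=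
  LinearMap.toContinuousLinearMap
    { toFun := fun a => !₂[a 0, a 1 / k]
      map_add' := fun a b => by ext i; fin_cases i <;> simp [add_div]
      map_smul' := fun c a => by ext i; fin_cases i <;> simp [mul_div_assoc] }

theorem contractGrad_apply (k : ℝ) (a : Vec) : contractGrad k a = !₂[a 0, a 1 / k] := rfl

theorem norm_contractGrad_le {k : ℝ} (hk : 1 ≤ k) (a : Vec) : ‖contractGrad k a‖ ≤ ‖a‖ := by
  rw [contractGrad_apply, EuclideanSpace.norm_eq, EuclideanSpace.norm_eq]
  gcongr with i
  fin_cases i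
  · simp
  · simp only [Fin.mk_one, Matrix.cons_val_one, Matrix.cons_val_fin_one, norm_div,
      Real.norm_eq_abs]
    exact div_le_self (abs_nonneg _) (hk.trans (le_abs_self k))

/-- `contract k` as a homeomorphism. -/
noncomputable def contractHomeomorph {k : ℝ} (hk : k ≠ 0) : ℝ × ℝ ≃ₜ ℝ × ℝ where
  toFun := contract k
  invFun z := (z.1, z.2 * k)
  left_inv z := by ext <;> simp [contract, hk]
  right_inv z := by ext <;> simp [contract, hk]
  continuous_toFun := by unfold contract; fun_prop
  continuous_invFun := by fun_prop

theorem measurableEmbedding_contract {k : ℝ} (hk : k ≠ 0) : MeasurableEmbedding (contract k) :=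
  (contractHomeomorph hk).measurableEmbedding

theorem map_contract_volume {k : ℝ} (hk : 0 < k) :
    Measure.map (contract k) volume = ENNReal.ofReal k • volume := by
  have h1 : contract k = Prod.map id (fun y : ℝ => k⁻¹ * y) := by
    ext z <;> simp [contract, div_eq_inv_mul]
  rw [h1, Measure.volume_eq_prod, ← Measure.map_prod_map _ _ measurable_id (by fun_prop),
    Measure.map_id, Real.map_volume_mul_left (by positivity), inv_inv, abs_of_pos hk,
    Measure.prod_smul_right]

theorem map_contract_restrict {k : ℝ} (hk : 0 < k) (U : Set (ℝ × ℝ)) :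
    Measure.map (contract k) (volume.restrict (contract k ⁻¹' U)) =
      ENNReal.ofReal k • volume.restrict U := by
  have he := measurableEmbedding_contract hk.ne'
  rw [← he.restrict_map, map_contract_volume hk, Measure.restrict_smul]

theorem integral_comp_contract {k : ℝ} (hk : 0 < k) (U : Set (ℝ × ℝ)) (f : ℝ × ℝ → ℝ) :
    ∫ z in contract k ⁻¹' U, f (contract k z) = k * ∫ z in U, f z := by
  have he := measurableEmbedding_contract hk.ne'
  rw [← he.integral_map, map_contract_restrict hk, integral_smul_measure,
    ENNReal.toReal_ofReal hk.le, smul_eq_mul]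

theorem memLp_comp_contract {E : Type*} [NormedAddCommGroup E] {k : ℝ} (hk : 0 < k)
    {U : Set (ℝ × ℝ)} {f : ℝ × ℝ → E} {p : ℝ≥0∞} (hf : MemLp f p (volume.restrict U)) :
    MemLp (fun z => f (contract k z)) p (volume.restrict (contract k ⁻¹' U)) := by
  have he := measurableEmbedding_contract hk.ne'
  have h := hf.smul_measure (c := ENNReal.ofReal k) (by simp)
  rw [← map_contract_restrict hk] at h
  exact (he.memLp_map_measure_iff).1 h

/-- Pull the test function back to `U` and change variables: the Jacobian `k` occurs on both sides
of the integration by parts, and the vertical derivative gains `1 / k`. -/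
theorem MemSobolev.comp_contract {p : ℝ} {U : Set (ℝ × ℝ)} {v : ℝ × ℝ → ℝ}
    {Dv : ℝ × ℝ → Vec} (hv : MemSobolev p U v Dv) {k : ℝ} (hk : 0 < k) :
    MemSobolev p (contract k ⁻¹' U) (fun z => v (contract k z))
      (fun z => contractGrad k (Dv (contract k z))) where
  memLp := memLp_comp_contract hk hv.memLp
  memLp_grad := (contractGrad k).comp_memLp' (memLp_comp_contract hk hv.memLp_grad)
  weakGradient := by
    intro φ hφ hφc hφU
    set e := contractHomeomorph hk.ne'
    have hec : ∀ z, e z = contract k z := fun _ => rfl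
    have hsymm : ⇑e.symm = fun z : ℝ × ℝ => (z.1, z.2 * k) := rfl
    set ψ : ℝ × ℝ → ℝ := fun z => φ (e.symm z) with hψ
    have hlin : ContDiff ℝ ∞ (fun z : ℝ × ℝ => ((z.1, z.2 * k) : ℝ × ℝ)) := by fun_prop
    have hψs : ContDiff ℝ ∞ ψ := by
      rw [hψ, hsymm]
      exact hφ.comp hlin
    have hψc : HasCompactSupport ψ := hφc.comp_homeomorph e.symm
    have hψU : tsupport ψ ⊆ U := by
      intro z hz
      have h1 := hφU (tsupport_comp_subset_preimage φ e.symm.continuous hz)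
      rwa [mem_preimage, ← hec, Homeomorph.apply_symm_apply] at h1
    have hφψ : ∀ z, φ z = ψ (contract k z) := fun z => by
      simp only [hψ]; rw [← hec, Homeomorph.symm_apply_apply]
    have hd : ∀ z a, fderiv ℝ φ z a = fderiv ℝ ψ (contract k z) (contract k a) := by
      intro z a
      have hl : IsLinearMap ℝ (contract k) :=
        ⟨fun x y => by ext <;> simp [contract, add_div],
          fun c x => by ext <;> simp [contract, mul_div_assoc]⟩
      set l : ℝ × ℝ →L[ℝ] ℝ × ℝ := LinearMap.toContinuousLinearMap (hl.mk' _)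
      have h2 : φ = fun z => ψ (l z) := funext hφψ
      have h3 := ((hψs.differentiable (by norm_num)) (l z)).hasFDerivAt.comp z l.hasFDerivAt
      have h4 : fderiv ℝ φ z = (fderiv ℝ ψ (l z)).comp l := by
        conv_lhs => rw [h2]
        exact h3.fderiv
      rw [h4]
      rfl
    have c1 : contract k (1, 0) = (1, 0) := by simp [contract]
    have c2 : contract k (0, 1) = k⁻¹ • (0, 1) := by simp [contract]
    obtain ⟨a, b⟩ := hv.weakGradient ψ hψs hψc hψU
    refine ⟨?_, ?_⟩
    · simp only [hd, hφψ, c1, contractGrad_apply, PiLp.toLp_apply, Matrix.cons_val_zero]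
      rw [integral_comp_contract hk U fun w => v w * fderiv ℝ ψ w (1, 0),
        integral_comp_contract hk U fun w => Dv w 0 * ψ w, a]
      ring
    · simp only [hd, hφψ, c2, contractGrad_apply, PiLp.toLp_apply, Matrix.cons_val_one,
        Matrix.cons_val_fin_one, map_smul, smul_eq_mul]
      rw [integral_comp_contract hk U fun w => v w * (k⁻¹ * fderiv ℝ ψ w (0, 1)),
        integral_comp_contract hk U fun w => Dv w 1 / k * ψ w]
      have e1 : ∀ w, v w * (k⁻¹ * fderiv ℝ ψ w (0, 1)) = k⁻¹ * (v w * fderiv ℝ ψ w (0, 1)) :=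
        fun w => by ring
      have e2 : ∀ w, Dv w 1 / k * ψ w = k⁻¹ * (Dv w 1 * ψ w) := fun w => by ring
      simp only [e1, e2, integral_const_mul, b]
      ring

/-! ### Uniform convexity of the `p`-th power of the norm. -/

section Convexity

variable {E : Type*} [NormedAddCommGroup E] [NormedSpace ℝ E]

theorem norm_half_add_rpow_le {p : ℝ} (hp : 1 ≤ p) (a b : E) :
    ‖(1 / 2 : ℝ) • (a + b)‖ ^ p ≤ 1 / 2 * (‖a‖ ^ p + ‖b‖ ^ p) := by
  have h1 : ‖(1 / 2 : ℝ) • (a + b)‖ ≤ 1 / 2 * ‖a‖ + 1 / 2 * ‖b‖ := by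
    rw [norm_smul, Real.norm_of_nonneg (by norm_num), ← mul_add]
    gcongr
    exact norm_add_le a b
  have h2 := (convexOn_rpow hp).2 (norm_nonneg a) (norm_nonneg b)
    (by norm_num : (0 : ℝ) ≤ 1 / 2) (by norm_num : (0 : ℝ) ≤ 1 / 2) (by norm_num)
  simp only [smul_eq_mul] at h2
  calc _ ≤ (1 / 2 * ‖a‖ + 1 / 2 * ‖b‖) ^ p := by gcongr
    _ ≤ _ := by linarith

/-- If the norms agree, strict convexity of the ball gives the gain; if they differ, strict
convexity of `t ↦ t ^ p` does. -/
theorem norm_half_add_rpow_lt [StrictConvexSpace ℝ E] {p : ℝ} (hp : 1 < p) {a b : E}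
    (hab : a ≠ b) : ‖(1 / 2 : ℝ) • (a + b)‖ ^ p < 1 / 2 * (‖a‖ ^ p + ‖b‖ ^ p) := by
  by_cases hn : ‖a‖ = ‖b‖
  · have h1 := norm_combo_lt_of_ne hn.le le_rfl hab (by norm_num : (0 : ℝ) < 1 / 2)
      (by norm_num : (0 : ℝ) < 1 / 2) (by norm_num)
    rw [← smul_add] at h1
    calc _ < ‖b‖ ^ p := Real.rpow_lt_rpow (norm_nonneg _) h1 (by linarith)
      _ = _ := by rw [hn]; ring
  · have h1 : ‖(1 / 2 : ℝ) • (a + b)‖ ≤ 1 / 2 * ‖a‖ + 1 / 2 * ‖b‖ := by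
      rw [norm_smul, Real.norm_of_nonneg (by norm_num), ← mul_add]
      gcongr
      exact norm_add_le a b
    have h2 := (strictConvexOn_rpow hp).2 (norm_nonneg a) (norm_nonneg b) hn
      (by norm_num : (0 : ℝ) < 1 / 2) (by norm_num : (0 : ℝ) < 1 / 2) (by norm_num)
    simp only [smul_eq_mul] at h2
    calc _ ≤ (1 / 2 * ‖a‖ + 1 / 2 * ‖b‖) ^ p := by gcongr
      _ < _ := by linarith

/-- Uniform convexity of `‖·‖ ^ p`: the distance between two points is controlled by the convexity
defect at their midpoint, up to an arbitrarily small multiple of their size. -/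
theorem exists_norm_sub_rpow_le [FiniteDimensional ℝ E] [StrictConvexSpace ℝ E] {p : ℝ}
    (hp : 1 < p) {θ : ℝ} (hθ : 0 < θ) :
    ∃ C : ℝ, 0 ≤ C ∧ ∀ a b : E, ‖a - b‖ ^ p ≤ θ * (‖a‖ ^ p + ‖b‖ ^ p) +
      C * (1 / 2 * (‖a‖ ^ p + ‖b‖ ^ p) - ‖(1 / 2 : ℝ) • (a + b)‖ ^ p) := by
  have hp0 : 0 < p := by linarith
  have : ProperSpace E := FiniteDimensional.proper_real E
  set D : E × E → ℝ := fun z =>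
    1 / 2 * (‖z.1‖ ^ p + ‖z.2‖ ^ p) - ‖(1 / 2 : ℝ) • (z.1 + z.2)‖ ^ p with hD
  have hc : ∀ {f : E × E → E}, Continuous f → Continuous fun z => ‖f z‖ ^ p := fun hf =>
    hf.norm.rpow_const fun _ => Or.inr hp0.le
  have hDc : Continuous D :=
    (((hc continuous_fst).add (hc continuous_snd)).const_mul _).sub (hc (by fun_prop))
  -- By homogeneity it is enough to treat pairs of total size `1`. Those at distance at least `θ`
  -- form a compact set, on which the defect `D` is continuous and positive, hence bounded below by
  -- some `m > 0`.
  set K : Set (E × E) := {z | ‖z.1‖ ^ p + ‖z.2‖ ^ p = 1} ∩ {z | θ ≤ ‖z.1 - z.2‖ ^ p} with hK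
  have hle1 : ∀ {t s : ℝ}, 0 ≤ t → 0 ≤ s → t ^ p + s ^ p = 1 → t ≤ 1 := by
    intro t s ht hs h
    by_contra hlt
    have := Real.one_lt_rpow (not_le.1 hlt) hp0
    linarith [Real.rpow_nonneg hs p]
  have hKc : IsCompact K := by
    refine (isCompact_closedBall (0 : E × E) 1).of_isClosed_subset ?_ ?_
    · exact (isClosed_eq ((hc continuous_fst).add (hc continuous_snd)) continuous_const).inter
        (isClosed_le continuous_const (hc (by fun_prop)))
    · rintro z ⟨hz, -⟩
      rw [mem_closedBall_zero_iff, Prod.norm_def]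
      exact max_le (hle1 (norm_nonneg _) (norm_nonneg _) hz)
        (hle1 (norm_nonneg _) (norm_nonneg _) ((add_comm _ _).trans hz))
  obtain ⟨m, hm, hmK⟩ : ∃ m : ℝ, 0 < m ∧ ∀ z ∈ K, m ≤ D z := by
    rcases K.eq_empty_or_nonempty with he | hne
    · exact ⟨1, one_pos, by simp [he]⟩
    · obtain ⟨z₀, hz₀, hmin⟩ := hKc.exists_isMinOn hne hDc.continuousOn
      refine ⟨D z₀, ?_, fun z hz => hmin hz⟩
      have hne' : z₀.1 ≠ z₀.2 := by
        intro he
        have := hz₀.2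
        simp only [mem_ofPred_eq, he, sub_self, norm_zero, Real.zero_rpow hp0.ne'] at this
        linarith
      have := norm_half_add_rpow_lt hp hne'
      simp only [hD]
      linarith
  -- For a normalised pair the distance is at most `2`, so on `K` the term `2 ^ p / m * D` alone
  -- suffices; off `K` the term with `θ` does.
  refine ⟨2 ^ p / m, by positivity, fun a b => ?_⟩
  have hD0 : ∀ z, 0 ≤ D z := fun z => by
    have := norm_half_add_rpow_le hp.le z.1 z.2
    simp only [hD]; linarith
  set s := ‖a‖ ^ p + ‖b‖ ^ p with hs
  have hs0 : 0 ≤ s := by positivity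
  rcases hs0.eq_or_lt with h0 | hspos
  · have ha : a = 0 := by
      by_contra hne
      have : 0 < ‖a‖ ^ p := Real.rpow_pos_of_pos (norm_pos_iff.2 hne) p
      have : 0 ≤ ‖b‖ ^ p := by positivity
      linarith
    have hb : b = 0 := by
      by_contra hne
      have : 0 < ‖b‖ ^ p := Real.rpow_pos_of_pos (norm_pos_iff.2 hne) p
      have : 0 ≤ ‖a‖ ^ p := by positivity
      linarith
    have := hD0 (a, b)
    simp only [hD, ← hs] at this
    have h2 : (0 : ℝ) ≤ 2 ^ p / m := by positivity
    rw [ha, hb, sub_self, norm_zero, Real.zero_rpow hp0.ne', ← h0]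
    simp [Real.zero_rpow hp0.ne']
  set r := s ^ (1 / p) with hr
  have hr0 : 0 < r := by positivity
  have hrp : r ^ p = s := by
    rw [hr, ← Real.rpow_mul hs0, one_div_mul_cancel hp0.ne', Real.rpow_one]
  have hscale : ∀ c : E, ‖c‖ ^ p = s * ‖r⁻¹ • c‖ ^ p := by
    intro c
    rw [norm_smul, norm_inv, Real.norm_of_nonneg hr0.le,
      Real.mul_rpow (by positivity) (norm_nonneg _), Real.inv_rpow hr0.le, hrp,
      mul_inv_cancel_left₀ hspos.ne']
  set a' := r⁻¹ • a with ha'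
  set b' := r⁻¹ • b with hb'
  have hsum : ‖a'‖ ^ p + ‖b'‖ ^ p = 1 := by
    have h1 := hscale a
    have h2 := hscale b
    have : s * (‖a'‖ ^ p + ‖b'‖ ^ p) = s * 1 := by rw [mul_add, ← h1, ← h2, mul_one]
    exact mul_left_cancel₀ hspos.ne' this
  have e1 : r⁻¹ • (a - b) = a' - b' := smul_sub _ _ _
  have e2 : r⁻¹ • ((1 / 2 : ℝ) • (a + b)) = (1 / 2 : ℝ) • (a' + b') := by
    rw [smul_comm, smul_add]
  have hDs : 1 / 2 * s - ‖(1 / 2 : ℝ) • (a + b)‖ ^ p = s * D (a', b') := by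
    rw [hscale ((1 / 2 : ℝ) • (a + b)), e2]
    simp only [hD]
    rw [hsum]
    ring
  rw [hscale (a - b), e1, hDs]
  have key : ‖a' - b'‖ ^ p ≤ θ + 2 ^ p / m * D (a', b') := by
    by_cases hcase : θ ≤ ‖a' - b'‖ ^ p
    · have h1 := hmK (a', b') ⟨hsum, hcase⟩
      have h2 : ‖a' - b'‖ ≤ 2 := by
        have := norm_sub_le a' b'
        have := hle1 (norm_nonneg _) (norm_nonneg _) hsum
        have := hle1 (norm_nonneg _) (norm_nonneg _) ((add_comm _ _).trans hsum)
        linarith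
      calc ‖a' - b'‖ ^ p ≤ 2 ^ p := by gcongr
        _ = 2 ^ p / m * m := by field_simp
        _ ≤ 2 ^ p / m * D (a', b') := by gcongr
        _ ≤ _ := by linarith
    · have : 0 ≤ 2 ^ p / m * D (a', b') := mul_nonneg (by positivity) (hD0 _)
      linarith
  calc s * ‖a' - b'‖ ^ p ≤ s * (θ + 2 ^ p / m * D (a', b')) := by gcongr
    _ = _ := by ring

end Convexity

/-! ### Young's inequality for the duality map. -/

section Duality

variable {E : Type*} [NormedAddCommGroup E] [InnerProductSpace ℝ E]

theorem rpow_sub_two_mul_inner_self {p : ℝ} (hp : 0 < p) (a : E) :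
    ‖a‖ ^ (p - 2) * inner ℝ a a = ‖a‖ ^ p := by
  rcases eq_or_ne a 0 with rfl | ha
  · simp [Real.zero_rpow hp.ne']
  · rw [real_inner_self_eq_norm_sq, ← Real.rpow_natCast,
      ← Real.rpow_add (norm_pos_iff.2 ha)]
    norm_num

/-- Cauchy–Schwarz, then Young for `‖a‖ ^ (p - 1)` and `‖b‖`, using `(p - 1) q = p`. -/
theorem rpow_sub_two_mul_inner_le {p q : ℝ} (hpq : p.HolderConjugate q) (a b : E) :
    ‖a‖ ^ (p - 2) * inner ℝ a b ≤ ‖a‖ ^ p / q + ‖b‖ ^ p / p := by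
  rcases eq_or_ne a 0 with rfl | ha
  · have := hpq.pos
    simp [Real.zero_rpow hpq.ne_zero]
    positivity
  · have ha' := norm_pos_iff.2 ha
    have h := Real.young_inequality_of_nonneg (Real.rpow_nonneg ha'.le (p - 1)) (norm_nonneg b)
      hpq.symm
    rw [← Real.rpow_mul ha'.le, hpq.sub_one_mul_conj] at h
    refine le_trans ?_ h
    calc ‖a‖ ^ (p - 2) * inner ℝ a b ≤ ‖a‖ ^ (p - 2) * (‖a‖ * ‖b‖) := by
          gcongr; exact real_inner_le_norm a b
      _ = ‖a‖ ^ (p - 1) * ‖b‖ := by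
          rw [← mul_assoc, ← Real.rpow_add_one ha'.ne']
          ring_nf

end Duality

/-! ### From a family of bounds to one modulus. -/

/-- Bounds that are arbitrarily small up to a vanishing error have a common modulus. -/
theorem exists_modulus (A : ℝ≥0 → ℝ≥0∞ → Prop) {η : ℝ≥0 → ℝ≥0} (hη : Tendsto η (𝓝 0) (𝓝 0))
    (K : ℝ≥0) (h : ∀ θ : ℝ≥0, 0 < θ → ∃ c : ℝ≥0, ∀ δ t, A δ t →
      t ≤ ((θ * K + c * η δ : ℝ≥0) : ℝ≥0∞)) :
    ∃ ρ : ℝ≥0 → ℝ≥0, Tendsto ρ (𝓝 0) (𝓝 0) ∧ ∀ δ t, A δ t → t ≤ (ρ δ : ℝ≥0∞) := by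
  choose! c hc using h
  -- The infimum over `θ` inherits every bound; to make it small, fix a small `θ` first and then let
  -- `δ` tend to `0`, so `c θ` may blow up as `θ` decreases.
  refine ⟨fun δ => ⨅ θ : {θ : ℝ≥0 // 0 < θ}, (θ.1 * K + c θ.1 * η δ), ?_, ?_⟩
  · rw [tendsto_order]
    refine ⟨fun a ha => absurd ha not_lt_zero, fun τ hτ => ?_⟩
    set θ : ℝ≥0 := τ / (2 * (K + 1)) with hθ
    have hθ0 : 0 < θ := by positivity
    have h1 : θ * K < τ := by
      rw [hθ, div_mul_eq_mul_div, div_lt_iff₀ (by positivity)]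
      gcongr
      have : (0 : ℝ≥0) ≤ K := zero_le
      linarith
    have h2 : Tendsto (fun δ => θ * K + c θ * η δ) (𝓝 0) (𝓝 (θ * K)) := by
      simpa using (hη.const_mul (c θ)).const_add (θ * K)
    filter_upwards [(tendsto_order.1 h2).2 τ h1] with δ hδ
    exact (ciInf_le (OrderBot.bddBelow _) (⟨θ, hθ0⟩ : {θ : ℝ≥0 // 0 < θ})).trans_lt hδ
  · intro δ t ht
    have : Nonempty {θ : ℝ≥0 // 0 < θ} := ⟨⟨1, one_pos⟩⟩
    rw [ENNReal.coe_iInf]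
    exact le_iInf fun θ => hc θ.1 θ.2 δ t ht

/-! ### Energies and the minimality of weak solutions. -/

/-- The `p`-energy `∫_S |w|^p + |∇w|^p`. -/
noncomputable def energy (p : ℝ) (S : Set (ℝ × ℝ)) (w : ℝ × ℝ → ℝ) (Dw : ℝ × ℝ → Vec) : ℝ :=
  ∫ z in S, (‖w z‖ ^ p + ‖Dw z‖ ^ p)

theorem integrable_norm_rpow_of_memLp {α E : Type*} [MeasurableSpace α] [NormedAddCommGroup E]
    {μ : Measure α} {p : ℝ} (hp : 0 < p) {w : α → E} (hw : MemLp w (ENNReal.ofReal p) μ) :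
    Integrable (fun z => ‖w z‖ ^ p) μ := by
  have := hw.integrable_norm_rpow (by simpa using hp) ENNReal.ofReal_ne_top
  rwa [ENNReal.toReal_ofReal hp.le] at this

theorem lintegral_enorm_rpow_eq {α E : Type*} [MeasurableSpace α] [NormedAddCommGroup E]
    {μ : Measure α} {p : ℝ} (hp : 0 < p) {w : α → E} (hw : MemLp w (ENNReal.ofReal p) μ) :
    ∫⁻ z, ‖w z‖ₑ ^ p ∂μ = ENNReal.ofReal (∫ z, ‖w z‖ ^ p ∂μ) := by
  rw [ofReal_integral_eq_lintegral_ofReal (integrable_norm_rpow_of_memLp hp hw)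
    (Eventually.of_forall fun z => by positivity)]
  refine lintegral_congr fun z => ?_
  rw [← ofReal_norm, ENNReal.ofReal_rpow_of_nonneg (norm_nonneg _) hp.le]

theorem MemSobolev.integrable_energy {p : ℝ} (hp : 0 < p) {S : Set (ℝ × ℝ)} {w : ℝ × ℝ → ℝ}
    {Dw : ℝ × ℝ → Vec} (hw : MemSobolev p S w Dw) :
    Integrable (fun z => ‖w z‖ ^ p + ‖Dw z‖ ^ p) (volume.restrict S) :=
  (integrable_norm_rpow_of_memLp hp hw.memLp).add (integrable_norm_rpow_of_memLp hp hw.memLp_grad)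

theorem energy_nonneg (p : ℝ) (S : Set (ℝ × ℝ)) (w : ℝ × ℝ → ℝ) (Dw : ℝ × ℝ → Vec) :
    0 ≤ energy p S w Dw :=
  integral_nonneg fun z => by positivity

theorem MemSobolev.energy_eq_add {p : ℝ} (hp : 0 < p) {S : Set (ℝ × ℝ)} {w : ℝ × ℝ → ℝ}
    {Dw : ℝ × ℝ → Vec} (hw : MemSobolev p S w Dw) :
    energy p S w Dw = (∫ z in S, ‖w z‖ ^ p) + ∫ z in S, ‖Dw z‖ ^ p :=
  integral_add (integrable_norm_rpow_of_memLp hp hw.memLp)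
    (integrable_norm_rpow_of_memLp hp hw.memLp_grad)

theorem MemSobolev.energy_add_diff {p : ℝ} (hp : 0 < p) {S T : Set (ℝ × ℝ)} {w : ℝ × ℝ → ℝ}
    {Dw : ℝ × ℝ → Vec} (hw : MemSobolev p S w Dw) (hT : MeasurableSet T) :
    energy p (S ∩ T) w Dw + energy p (S \ T) w Dw = energy p S w Dw :=
  integral_inter_add_sdiff hT (hw.integrable_energy hp)

theorem MemSobolev.lintegral_energy {p : ℝ} (hp : 0 < p) {S T : Set (ℝ × ℝ)} {w : ℝ × ℝ → ℝ}
    {Dw : ℝ × ℝ → Vec} (hw : MemSobolev p S w Dw) (hTS : T ⊆ S) :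
    ∫⁻ z in T, (‖w z‖ₑ ^ p + ‖Dw z‖ₑ ^ p) = ENNReal.ofReal (energy p T w Dw) := by
  have hi : Integrable (fun z => ‖w z‖ ^ p + ‖Dw z‖ ^ p) (volume.restrict T) :=
    (hw.integrable_energy hp).mono_measure (Measure.restrict_mono hTS le_rfl)
  rw [energy, ofReal_integral_eq_lintegral_ofReal hi (Eventually.of_forall fun z => by positivity)]
  refine lintegral_congr fun z => ?_
  rw [ENNReal.ofReal_add (by positivity) (by positivity), ← ofReal_norm, ← ofReal_norm,
    ENNReal.ofReal_rpow_of_nonneg (norm_nonneg _) hp.le,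
    ENNReal.ofReal_rpow_of_nonneg (norm_nonneg _) hp.le]

theorem abs_integral_mul_le {p q : ℝ} (hpq : p.HolderConjugate q) {μ : Measure (ℝ × ℝ)}
    {f w : ℝ × ℝ → ℝ} (hf : MemLp f (ENNReal.ofReal q) μ) (hw : MemLp w (ENNReal.ofReal p) μ) :
    |∫ z, f z * w z ∂μ| ≤ (∫ z, ‖f z‖ ^ q ∂μ) ^ (1 / q) * (∫ z, ‖w z‖ ^ p ∂μ) ^ (1 / p) := by
  refine (norm_integral_le_integral_norm (μ := μ) (fun z => f z * w z)).trans ?_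
  simp only [norm_mul]
  exact integral_mul_le_Lp_mul_Lq_of_nonneg hpq.symm
    (Eventually.of_forall fun _ => norm_nonneg _) (Eventually.of_forall fun _ => norm_nonneg _)
    hf.norm hw.norm

/-- Since `1 / p + 1 / q = 1`, Hölder's inequality gives a bound linear in `M`; this is what later
survives division by `ε`. -/
theorem abs_integral_mul_le_mul {p q : ℝ} (hpq : p.HolderConjugate q) {μ : Measure (ℝ × ℝ)}
    {f w : ℝ × ℝ → ℝ} (hf : MemLp f (ENNReal.ofReal q) μ) (hw : MemLp w (ENNReal.ofReal p) μ)
    {M κ : ℝ} (hM : 0 ≤ M) (hκ : 0 ≤ κ) (hfM : ∫ z, ‖f z‖ ^ q ∂μ ≤ M)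
    (hwM : ∫ z, ‖w z‖ ^ p ∂μ ≤ κ * M) :
    |∫ z, f z * w z ∂μ| ≤ M * κ ^ (1 / p) := by
  have hp := hpq.pos
  have hq := hpq.symm.pos
  have h0 : 0 ≤ ∫ z, ‖f z‖ ^ q ∂μ := integral_nonneg fun z => by positivity
  have h1 : 0 ≤ ∫ z, ‖w z‖ ^ p ∂μ := integral_nonneg fun z => by positivity
  calc _ ≤ (∫ z, ‖f z‖ ^ q ∂μ) ^ (1 / q) * (∫ z, ‖w z‖ ^ p ∂μ) ^ (1 / p) :=
        abs_integral_mul_le hpq hf hw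
    _ ≤ M ^ (1 / q) * (κ * M) ^ (1 / p) := by gcongr
    _ = M ^ (1 / q + 1 / p) * κ ^ (1 / p) := by
        rw [Real.mul_rpow hκ hM, Real.rpow_add_of_nonneg hM (by positivity) (by positivity)]
        ring
    _ = M * κ ^ (1 / p) := by
        have : 1 / q + 1 / p = 1 := by simpa using hpq.symm.inv_add_inv_eq_one
        rw [this, Real.rpow_one]

theorem IsWeakSolution.integral_eq_energy {p : ℝ} (hp : 0 < p) {U : Set (ℝ × ℝ)}
    {f u : ℝ × ℝ → ℝ} {Du : ℝ × ℝ → Vec} (hu : IsWeakSolution p U f u Du) :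
    ∫ z in U, f z * u z = energy p U u Du := by
  rw [← hu.weak_eq u Du hu.memSobolev, energy]
  refine integral_congr_ae (Eventually.of_forall fun z => ?_)
  have h := rpow_sub_two_mul_inner_self hp (u z)
  simp only [Real.norm_eq_abs, RCLike.inner_apply, conj_trivial, ← mul_assoc] at h
  simp only [rpow_sub_two_mul_inner_self hp (Du z), Real.norm_eq_abs]
  linarith

/-- This is minimality of `u` for `v ↦ energy v / p - ∫ f v`, whose value at `u` is `-energy u / q`.
-/
theorem IsWeakSolution.integral_mul_le {p q : ℝ} (hpq : p.HolderConjugate q) {U : Set (ℝ × ℝ)}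
    {f u : ℝ × ℝ → ℝ} {Du : ℝ × ℝ → Vec} (hu : IsWeakSolution p U f u Du) {v : ℝ × ℝ → ℝ}
    {Dv : ℝ × ℝ → Vec} (hv : MemSobolev p U v Dv) :
    ∫ z in U, f z * v z ≤ energy p U u Du / q + energy p U v Dv / p := by
  have hp := hpq.pos
  have hq := hpq.symm.pos
  rw [← hu.weak_eq v Dv hv]
  have h0 := energy_nonneg p U u Du
  have h1 := energy_nonneg p U v Dv
  by_cases hi : Integrable (fun z => ‖Du z‖ ^ (p - 2) * inner ℝ (Du z) (Dv z) +
      |u z| ^ (p - 2) * u z * v z) (volume.restrict U)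
  · have i1 := (hu.memSobolev.integrable_energy hp).div_const q
    have i2 := (hv.integrable_energy hp).div_const p
    rw [energy, energy, ← integral_div, ← integral_div, ← integral_add i1 i2]
    refine integral_mono hi (i1.add i2) fun z => ?_
    have e1 := rpow_sub_two_mul_inner_le hpq (u z) (v z)
    have e2 := rpow_sub_two_mul_inner_le hpq (Du z) (Dv z)
    simp only [Real.norm_eq_abs, RCLike.inner_apply, conj_trivial] at e1
    simp only [add_div, Real.norm_eq_abs]
    rw [show |u z| ^ (p - 2) * u z * v z = |u z| ^ (p - 2) * (v z * u z) by ring]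
    linarith
  -- Without integrability the integral is `0` by convention, and the right side is nonnegative.
  · rw [integral_undef hi]
    positivity

/-- Test with `u`, apply Young, and absorb `energy u / p`: since `1 - 1 / p = 1 / q`, the constant
is exactly `1`. -/
theorem IsWeakSolution.energy_le {p q : ℝ} (hpq : p.HolderConjugate q) {U : Set (ℝ × ℝ)}
    {f u : ℝ × ℝ → ℝ} {Du : ℝ × ℝ → Vec} (hu : IsWeakSolution p U f u Du)
    (hf : MemLp f (ENNReal.ofReal q) (volume.restrict U)) :
    energy p U u Du ≤ ∫ z in U, ‖f z‖ ^ q := by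
  have hp := hpq.pos
  have hq := hpq.symm.pos
  have hfi := (integrable_norm_rpow_of_memLp hq hf).div_const q
  have hui := (hu.memSobolev.integrable_energy hp).div_const p
  have h1 : ∫ z in U, f z * u z ≤ (∫ z in U, ‖f z‖ ^ q) / q + energy p U u Du / p := by
    rw [energy, ← integral_div, ← integral_div, ← integral_add hfi hui]
    refine integral_mono ?_ (hfi.add hui) fun z => ?_
    · have : ENNReal.HolderConjugate (ENNReal.ofReal q) (ENNReal.ofReal p) :=
        hpq.symm.ennrealOfReal
      exact hf.integrable_mul hu.memSobolev.memLp
    · have := Real.young_inequality (f z) (u z) hpq.symm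
      have h2 : 0 ≤ ‖Du z‖ ^ p / p := by positivity
      simp only [add_div, Real.norm_eq_abs] at this h2 ⊢
      linarith
  rw [hu.integral_eq_energy hp] at h1
  have h3 : 1 / q = 1 - 1 / p := by
    have := hpq.inv_add_inv_eq_one
    simp only [one_div]; linarith
  have h4 : energy p U u Du * (1 / q) ≤ (∫ z in U, ‖f z‖ ^ q) * (1 / q) := by
    rw [div_eq_mul_one_div, div_eq_mul_one_div (energy p U u Du) p] at h1
    have : energy p U u Du * (1 / q) = energy p U u Du - energy p U u Du * (1 / p) := by
      rw [h3]; ring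
    linarith
  exact le_of_mul_le_mul_right h4 (by positivity)

/-- The Jacobian costs a factor `k`, while for `k ≥ 1` the gradient only shrinks. -/
theorem MemSobolev.energy_comp_contract_le {p : ℝ} (hp : 0 < p) {U : Set (ℝ × ℝ)} {v : ℝ × ℝ → ℝ}
    {Dv : ℝ × ℝ → Vec} (hv : MemSobolev p U v Dv) {k : ℝ} (hk : 1 ≤ k) :
    energy p (contract k ⁻¹' U) (fun z => v (contract k z))
      (fun z => contractGrad k (Dv (contract k z))) ≤ k * energy p U v Dv := by
  have hk0 : 0 < k := by linarith
  rw [energy, energy, ← integral_comp_contract hk0 U fun z => ‖v z‖ ^ p + ‖Dv z‖ ^ p]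
  refine integral_mono_of_nonneg (Eventually.of_forall fun z => by positivity) ?_
    (Eventually.of_forall fun z => ?_)
  · exact (integrable_norm_rpow_of_memLp hp (memLp_comp_contract hk0 hv.memLp)).add
      (integrable_norm_rpow_of_memLp hp (memLp_comp_contract hk0 hv.memLp_grad))
  · simp only
    gcongr
    exact norm_contractGrad_le hk _

theorem MemSobolev.integral_sub_contract_le {p : ℝ} (hp : 1 < p) {h : ℝ → ℝ}
    (hh : ContinuousOffFinite h) {b : ℝ} (hb0 : 0 ≤ b) (hb : ∀ x ∈ Ioo (0 : ℝ) 1, h x ≤ b)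
    {w : ℝ × ℝ → ℝ} {Dw : ℝ × ℝ → Vec} (hw : MemSobolev p (subgraph h) w Dw)
    {k : ℝ} (hk : 1 ≤ k)
    (hwk : MemLp (fun z => w (contract k z)) (ENNReal.ofReal p) (volume.restrict (subgraph h))) :
    ∫ z in subgraph h, ‖w z - w (contract k z)‖ ^ p ≤
      b * (b * (k - 1)) ^ (p - 1) * energy p (subgraph h) w Dw := by
  have hp0 : 0 < p := by linarith
  have hbk : 0 ≤ b * (k - 1) := mul_nonneg hb0 (by linarith)
  have key := hw.lintegral_sub_stretch_le hp hh hb hk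
  have e1 := lintegral_enorm_rpow_eq hp0 (hw.memLp.sub hwk)
  simp only [Pi.sub_apply] at e1
  change ∫⁻ z in subgraph h, ‖w z - w (contract k z)‖ₑ ^ p ≤ _ at key
  have hI : 0 ≤ ∫ z in subgraph h, ‖Dw z‖ ^ p := integral_nonneg fun z => by positivity
  rw [e1, lintegral_enorm_rpow_eq hp0 hw.memLp_grad,
    ENNReal.ofReal_rpow_of_nonneg hbk (by linarith), ← ENNReal.ofReal_mul hb0,
    ← ENNReal.ofReal_mul (by positivity), ENNReal.ofReal_le_ofReal_iff (by positivity)] at key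
  refine key.trans ?_
  gcongr
  rw [hw.energy_eq_add hp0]
  have : 0 ≤ ∫ z in subgraph h, ‖w z‖ ^ p := integral_nonneg fun z => by positivity
  linarith

/-- Measuring the strip height relative to `a` lets `a` cancel, so the bound does not degenerate
when `a = ε G₀` is small. -/
theorem MemSobolev.integral_strip_le {p : ℝ} (hp : 1 < p) {h h' : ℝ → ℝ}
    (hh : ContinuousOffFinite h) (hh' : ContinuousOffFinite h') {a b η : ℝ} (ha0 : 0 < a)
    (hb0 : 0 ≤ b) (hη : 0 ≤ η)
    (ha : ∀ x ∈ Ioo (0 : ℝ) 1, a ≤ h x) (hb : ∀ x ∈ Ioo (0 : ℝ) 1, h x ≤ b)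
    (hc : ∀ x ∈ Ioo (0 : ℝ) 1, h x - h' x ≤ η * a)
    {w : ℝ × ℝ → ℝ} {Dw : ℝ × ℝ → Vec} (hw : MemSobolev p (subgraph h) w Dw) :
    ∫ z in subgraph h \ subgraph h', ‖w z‖ ^ p ≤
      η * (2 ^ (p - 1) * (1 + b ^ p)) * energy p (subgraph h) w Dw := by
  have hp0 : 0 < p := by linarith
  have key := hw.lintegral_strip_le hp hh hh' ha hb hc
  have hI : 0 ≤ ∫ z in subgraph h, ‖Dw z‖ ^ p := integral_nonneg fun z => by positivity
  have hJ : 0 ≤ ∫ z in subgraph h, ‖w z‖ ^ p := integral_nonneg fun z => by positivity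
  have e2 : (2 : ℝ≥0∞) ^ (p - 1) = ENNReal.ofReal (2 ^ (p - 1)) := by
    rw [← ENNReal.ofReal_rpow_of_nonneg (by norm_num) (by linarith)]; simp
  rw [lintegral_enorm_rpow_eq hp0
      (hw.memLp.mono_measure (Measure.restrict_mono sdiff_subset le_rfl)),
    lintegral_enorm_rpow_eq hp0 hw.memLp, lintegral_enorm_rpow_eq hp0 hw.memLp_grad,
    ENNReal.ofReal_rpow_of_nonneg hb0 hp0.le, e2, ← ENNReal.ofReal_mul (by positivity),
    ← ENNReal.ofReal_mul (by positivity), ← ENNReal.ofReal_add hJ (by positivity),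
    ← ENNReal.ofReal_mul (by positivity), ← ENNReal.ofReal_mul (by positivity),
    ENNReal.ofReal_le_ofReal_iff (by positivity)] at key
  have h1 : (∫ z in subgraph h \ subgraph h', ‖w z‖ ^ p) ≤ η * (2 ^ (p - 1) *
      ((∫ z in subgraph h, ‖w z‖ ^ p) + b ^ p * ∫ z in subgraph h, ‖Dw z‖ ^ p)) := by
    refine le_of_mul_le_mul_left (key.trans_eq ?_) ha0
    ring
  refine h1.trans ?_
  rw [hw.energy_eq_add hp0, mul_assoc η, mul_assoc ((2 : ℝ) ^ (p - 1))]
  gcongr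
  have hbp : 0 ≤ b ^ p := by positivity
  nlinarith [mul_nonneg hbp hJ]

/-! ### Comparison of weak solutions on two subgraphs. -/

theorem subgraph_inf (h h' : ℝ → ℝ) :
    subgraph (fun x => min (h x) (h' x)) = subgraph h ∩ subgraph h' := by
  ext z
  simp [subgraph]
  tauto

theorem ContinuousOffFinite.min {h h' : ℝ → ℝ} (hh : ContinuousOffFinite h)
    (hh' : ContinuousOffFinite h') : ContinuousOffFinite fun x => min (h x) (h' x) := by
  obtain ⟨F, hF, hc⟩ := hh
  obtain ⟨F', hF', hc'⟩ := hh'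
  refine ⟨F ∪ F', hF.union hF', ?_⟩
  exact continuous_min.comp_continuousOn
    ((hc.mono (sdiff_subset_sdiff_right subset_union_left)).prodMk
      (hc'.mono (sdiff_subset_sdiff_right subset_union_right)))

theorem MemSobolev.sub {p : ℝ} (hp : 1 ≤ p) {U : Set (ℝ × ℝ)} {u v : ℝ × ℝ → ℝ}
    {Du Dv : ℝ × ℝ → Vec} (hu : MemSobolev p U u Du) (hv : MemSobolev p U v Dv) :
    MemSobolev p U (fun z => u z - v z) (fun z => Du z - Dv z) := by
  simpa [sub_eq_add_neg] using hu.add hp (hv.const_mul (-1))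

/-- The factor by which a strip of relative height `η` reduces the `p`-th power of the `L^p` norm of
a Sobolev function on a subgraph of height at most `b`. -/
noncomputable def stripFactor (p b η : ℝ) : ℝ := η * (2 ^ (p - 1) * (1 + b ^ p))

/-- The factor by which the `p`-th power of the `L^p` distance between a Sobolev function on a
subgraph of height at most `b` and its vertical stretching by `1 + η` is controlled. -/
noncomputable def stretchFactor (p b η : ℝ) : ℝ := b * (b * η) ^ (p - 1)

theorem stripFactor_nonneg {p b η : ℝ} (hb : 0 ≤ b) (hη : 0 ≤ η) : 0 ≤ stripFactor p b η := by
  unfold stripFactor; positivity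

theorem stretchFactor_nonneg {p b η : ℝ} (hb : 0 ≤ b) (hη : 0 ≤ η) : 0 ≤ stretchFactor p b η := by
  unfold stretchFactor; positivity

/-- A Sobolev function on a slightly smaller subgraph is almost admissible in the minimality
inequality of a weak solution. -/
theorem IsWeakSolution.integral_mul_le_of_subset {p q : ℝ} (hpq : p.HolderConjugate q)
    {h m : ℝ → ℝ} (hh : ContinuousOffFinite h) (hm : ContinuousOffFinite m) {a b η M : ℝ}
    (ha0 : 0 < a) (hb0 : 0 ≤ b) (hη : 0 ≤ η) (hM : 0 ≤ M)
    (hmh : ∀ x ∈ Ioo (0 : ℝ) 1, m x ≤ h x) (ha : ∀ x ∈ Ioo (0 : ℝ) 1, a ≤ m x)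
    (hb : ∀ x ∈ Ioo (0 : ℝ) 1, h x ≤ b) (hc : ∀ x ∈ Ioo (0 : ℝ) 1, h x - m x ≤ η * a)
    {f u : ℝ × ℝ → ℝ} {Du : ℝ × ℝ → Vec} (hu : IsWeakSolution p (subgraph h) f u Du)
    (hf : MemLp f (ENNReal.ofReal q) volume) (hfM : ∫ z in subgraph h, ‖f z‖ ^ q ≤ M)
    {w : ℝ × ℝ → ℝ} {Dw : ℝ × ℝ → Vec} (hw : MemSobolev p (subgraph m) w Dw)
    (hwM : energy p (subgraph m) w Dw ≤ M) :
    ∫ z in subgraph m, f z * w z ≤ energy p (subgraph h) u Du / q +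
      energy p (subgraph m) w Dw / p + η * M / p +
      M * (stretchFactor p b η ^ (1 / p) + (stripFactor p b η * (1 + η)) ^ (1 / p)) := by
  have hp := hpq.lt
  have hp0 := hpq.pos
  have hq0 := hpq.symm.pos
  have hk : 1 ≤ 1 + η := by linarith
  have hk0 : 0 < 1 + η := by linarith
  have hIm := measurableSet_subgraph hm
  have hIU : subgraph m ⊆ subgraph h := fun z hz => ⟨hz.1, hz.2.1, hz.2.2.trans_le (hmh _ hz.1)⟩
  have hTm : MeasurableSet (contract (1 + η) ⁻¹' subgraph m) :=
    (measurableEmbedding_contract hk0.ne').measurable hIm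
  -- `h ≤ m + η a ≤ (1 + η) m`: this is why `1 + η` is the right stretching factor.
  have hUT : subgraph h ⊆ contract (1 + η) ⁻¹' subgraph m := by
    rintro z ⟨h1, h2, h3⟩
    refine ⟨h1, by simp only [contract]; positivity, ?_⟩
    simp only [contract]
    rw [div_lt_iff₀ hk0]
    nlinarith [hc _ h1, ha _ h1]
  have hVT := hw.comp_contract hk0
  set V : ℝ × ℝ → ℝ := fun z => w (contract (1 + η) z) with hV
  set DV : ℝ × ℝ → Vec := fun z => contractGrad (1 + η) (Dw (contract (1 + η) z))
  have hVU : MemSobolev p (subgraph h) V DV := hVT.mono hTm hUT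
  have hEV : energy p (subgraph h) V DV ≤ (1 + η) * energy p (subgraph m) w Dw := by
    refine le_trans ?_ (hw.energy_comp_contract_le hp0 hk)
    exact setIntegral_mono_set (hVT.integrable_energy hp0)
      (Eventually.of_forall fun z => by positivity) hUT.eventuallyLE
  have hEw := energy_nonneg p (subgraph m) w Dw
  have hVI : MemLp V (ENNReal.ofReal p) (volume.restrict (subgraph m)) :=
    hVU.memLp.mono_measure (Measure.restrict_mono hIU le_rfl)
  have hfU := hf.restrict (subgraph h)
  have hfi : Integrable (fun z => ‖f z‖ ^ q) (volume.restrict (subgraph h)) :=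
    integrable_norm_rpow_of_memLp hq0 hfU
  have hfS : ∀ S ⊆ subgraph h, ∫ z in S, ‖f z‖ ^ q ≤ M := fun S hS =>
    (setIntegral_mono_set hfi (Eventually.of_forall fun z => by positivity)
      hS.eventuallyLE).trans hfM
  -- The load on `w` equals the load on `V` over the larger subgraph, plus the stretching error
  -- bounded here, minus the strip error bounded next.
  have hA : |∫ z in subgraph m, f z * (w z - V z)| ≤ M * stretchFactor p b η ^ (1 / p) := by
    refine abs_integral_mul_le_mul hpq (hf.restrict _) (hw.memLp.sub hVI) hM
      (stretchFactor_nonneg hb0 hη) (hfS _ hIU) ?_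
    have h1 := hw.integral_sub_contract_le hp hm hb0 (fun x hx => (hmh x hx).trans (hb x hx))
      hk hVI
    rw [add_sub_cancel_left] at h1
    refine h1.trans (mul_le_mul_of_nonneg_left hwM (stretchFactor_nonneg hb0 hη))
  have hB : |∫ z in subgraph h \ subgraph m, f z * V z| ≤
      M * (stripFactor p b η * (1 + η)) ^ (1 / p) := by
    refine abs_integral_mul_le_mul hpq (hf.restrict _)
      (hVU.memLp.mono_measure (Measure.restrict_mono sdiff_subset le_rfl)) hM
      (mul_nonneg (stripFactor_nonneg hb0 hη) hk0.le) (hfS _ sdiff_subset) ?_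
    refine (hVU.integral_strip_le hp hh hm ha0 hb0 hη
      (fun x hx => (ha x hx).trans (hmh x hx)) hb hc).trans ?_
    rw [mul_assoc (stripFactor p b η)]
    refine mul_le_mul_of_nonneg_left (hEV.trans ?_) (stripFactor_nonneg hb0 hη)
    gcongr
  have hconj : ENNReal.HolderConjugate (ENNReal.ofReal q) (ENNReal.ofReal p) :=
    hpq.symm.ennrealOfReal
  have hi : Integrable (fun z => f z * V z) (volume.restrict (subgraph h)) :=
    hfU.integrable_mul hVU.memLp
  have hsplit : (∫ z in subgraph m, f z * V z) + ∫ z in subgraph h \ subgraph m, f z * V z =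
      ∫ z in subgraph h, f z * V z := by
    have := integral_inter_add_sdiff hIm hi
    rwa [inter_eq_self_of_subset_right hIU] at this
  have hsub : ∫ z in subgraph m, f z * (w z - V z) =
      (∫ z in subgraph m, f z * w z) - ∫ z in subgraph m, f z * V z := by
    simp only [mul_sub]
    exact integral_sub ((hf.restrict _).integrable_mul hw.memLp)
      ((hf.restrict _).integrable_mul hVI)
  have hmin := hu.integral_mul_le hpq hVU
  have h5 : energy p (subgraph h) V DV / p ≤ energy p (subgraph m) w Dw / p + η * M / p := by
    rw [← add_div]
    gcongr
    have : η * energy p (subgraph m) w Dw ≤ η * M := by gcongr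
    linarith
  have := (abs_le.1 hA).2
  have := (abs_le.1 hB).1
  linarith

/-- The load on a weak solution is almost entirely carried by a slightly smaller subgraph. -/
theorem IsWeakSolution.energy_le_integral_of_subset {p q : ℝ} (hpq : p.HolderConjugate q)
    {h m : ℝ → ℝ} (hh : ContinuousOffFinite h) (hm : ContinuousOffFinite m) {a b η M : ℝ}
    (ha0 : 0 < a) (hb0 : 0 ≤ b) (hη : 0 ≤ η) (hM : 0 ≤ M)
    (hmh : ∀ x ∈ Ioo (0 : ℝ) 1, m x ≤ h x) (ha : ∀ x ∈ Ioo (0 : ℝ) 1, a ≤ m x)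
    (hb : ∀ x ∈ Ioo (0 : ℝ) 1, h x ≤ b) (hc : ∀ x ∈ Ioo (0 : ℝ) 1, h x - m x ≤ η * a)
    {f u : ℝ × ℝ → ℝ} {Du : ℝ × ℝ → Vec} (hu : IsWeakSolution p (subgraph h) f u Du)
    (hf : MemLp f (ENNReal.ofReal q) volume) (hfM : ∫ z in subgraph h, ‖f z‖ ^ q ≤ M) :
    energy p (subgraph h) u Du ≤ (∫ z in subgraph m, f z * u z) +
      M * (stripFactor p b η * (1 + η)) ^ (1 / p) := by
  have hp := hpq.lt
  have hp0 := hpq.pos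
  have hq0 := hpq.symm.pos
  have hIm := measurableSet_subgraph hm
  have hIU : subgraph m ⊆ subgraph h := fun z hz => ⟨hz.1, hz.2.1, hz.2.2.trans_le (hmh _ hz.1)⟩
  have hfU := hf.restrict (subgraph h)
  have hfi : Integrable (fun z => ‖f z‖ ^ q) (volume.restrict (subgraph h)) :=
    integrable_norm_rpow_of_memLp hq0 hfU
  have hE := (hu.energy_le hpq hfU).trans hfM
  have hconj : ENNReal.HolderConjugate (ENNReal.ofReal q) (ENNReal.ofReal p) :=
    hpq.symm.ennrealOfReal
  have hsplit := integral_inter_add_sdiff hIm (hfU.integrable_mul hu.memSobolev.memLp)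
  rw [inter_eq_self_of_subset_right hIU] at hsplit
  simp only [Pi.mul_apply] at hsplit
  rw [hu.integral_eq_energy hp0] at hsplit
  have hκ := stripFactor_nonneg (p := p) hb0 hη
  have hB : |∫ z in subgraph h \ subgraph m, f z * u z| ≤
      M * (stripFactor p b η * (1 + η)) ^ (1 / p) := by
    refine abs_integral_mul_le_mul hpq (hf.restrict _)
      (hu.memSobolev.memLp.mono_measure (Measure.restrict_mono sdiff_subset le_rfl)) hM
      (mul_nonneg hκ (by linarith)) ((setIntegral_mono_set hfi
        (Eventually.of_forall fun z => by positivity) sdiff_subset.eventuallyLE).trans hfM) ?_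
    refine (hu.memSobolev.integral_strip_le hp hh hm ha0 hb0 hη
      (fun x hx => (ha x hx).trans (hmh x hx)) hb hc).trans ?_
    -- The bound is loosened by `1 + η` to match the strip error in the midpoint estimate.
    refine (mul_le_mul_of_nonneg_left hE hκ).trans ?_
    gcongr
    nlinarith
  have := (abs_le.1 hB).2
  linarith

/-- The energy estimate behind the stability of weak solutions with respect to the domain. -/
theorem energy_sub_add_energy_diff_le {p q : ℝ} (hpq : p.HolderConjugate q) {h h' : ℝ → ℝ}
    (hh : ContinuousOffFinite h) (hh' : ContinuousOffFinite h') {a b η M : ℝ}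
    (ha0 : 0 < a) (hb0 : 0 ≤ b) (hη : 0 ≤ η) (hM : 0 ≤ M)
    (ha : ∀ x ∈ Ioo (0 : ℝ) 1, a ≤ h x) (ha' : ∀ x ∈ Ioo (0 : ℝ) 1, a ≤ h' x)
    (hb : ∀ x ∈ Ioo (0 : ℝ) 1, h x ≤ b) (hb' : ∀ x ∈ Ioo (0 : ℝ) 1, h' x ≤ b)
    (hc : ∀ x ∈ Ioo (0 : ℝ) 1, |h x - h' x| ≤ η * a)
    {f u u' : ℝ × ℝ → ℝ} {Du Du' : ℝ × ℝ → Vec}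
    (hu : IsWeakSolution p (subgraph h) f u Du) (hu' : IsWeakSolution p (subgraph h') f u' Du')
    (hf : MemLp f (ENNReal.ofReal q) volume)
    (hfM : ∫ z in subgraph h ∪ subgraph h', ‖f z‖ ^ q ≤ M) {θ C : ℝ} (hθ : 0 ≤ θ) (hC : 0 ≤ C)
    (hconv : ∀ a b : ℝ, ‖a - b‖ ^ p ≤ θ * (‖a‖ ^ p + ‖b‖ ^ p) +
      C * (1 / 2 * (‖a‖ ^ p + ‖b‖ ^ p) - ‖(1 / 2 : ℝ) • (a + b)‖ ^ p))
    (hconv' : ∀ a b : Vec, ‖a - b‖ ^ p ≤ θ * (‖a‖ ^ p + ‖b‖ ^ p) +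
      C * (1 / 2 * (‖a‖ ^ p + ‖b‖ ^ p) - ‖(1 / 2 : ℝ) • (a + b)‖ ^ p)) :
    energy p (subgraph h ∩ subgraph h') (fun z => u z - u' z) (fun z => Du z - Du' z) +
        energy p (subgraph h \ subgraph h') u Du + energy p (subgraph h' \ subgraph h) u' Du' ≤
      M * (2 * θ + (C + 2) * (η + p * (stretchFactor p b η ^ (1 / p) +
        2 * (stripFactor p b η * (1 + η)) ^ (1 / p)))) := by
  have hp := hpq.lt
  have hp0 := hpq.pos
  have hq0 := hpq.symm.pos
  set U := subgraph h
  set U' := subgraph h'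
  have hUm : MeasurableSet U := measurableSet_subgraph hh
  have hUm' : MeasurableSet U' := measurableSet_subgraph hh'
  set m : ℝ → ℝ := fun x => min (h x) (h' x) with hm
  have hmc : ContinuousOffFinite m := hh.min hh'
  have hI : subgraph m = U ∩ U' := subgraph_inf h h'
  have hIm := measurableSet_subgraph hmc
  have hIU : subgraph m ⊆ U := hI ▸ inter_subset_left
  have hIU' : subgraph m ⊆ U' := hI ▸ inter_subset_right
  have hmh : ∀ x ∈ Ioo (0 : ℝ) 1, m x ≤ h x := fun x _ => min_le_left _ _
  have hmh' : ∀ x ∈ Ioo (0 : ℝ) 1, m x ≤ h' x := fun x _ => min_le_right _ _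
  have ham : ∀ x ∈ Ioo (0 : ℝ) 1, a ≤ m x := fun x hx => le_min (ha x hx) (ha' x hx)
  have hηa : 0 ≤ η * a := by positivity
  have hcm : ∀ x ∈ Ioo (0 : ℝ) 1, h x - m x ≤ η * a := fun x hx => by
    have := abs_le.1 (hc x hx)
    rcases min_choice (h x) (h' x) with e | e <;> simp only [hm, e] <;> linarith
  have hcm' : ∀ x ∈ Ioo (0 : ℝ) 1, h' x - m x ≤ η * a := fun x hx => by
    have := abs_le.1 (hc x hx)
    rcases min_choice (h x) (h' x) with e | e <;> simp only [hm, e] <;> linarith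
  have hfi : Integrable (fun z => ‖f z‖ ^ q) (volume.restrict (U ∪ U')) :=
    integrable_norm_rpow_of_memLp hq0 (hf.restrict _)
  have hfS : ∀ S ⊆ U ∪ U', ∫ z in S, ‖f z‖ ^ q ≤ M := fun S hS =>
    (setIntegral_mono_set hfi (Eventually.of_forall fun z => by positivity)
      hS.eventuallyLE).trans hfM
  have hfU := hfS U subset_union_left
  have hfU' := hfS U' subset_union_right
  have hE := (hu.energy_le hpq (hf.restrict _)).trans hfU
  have hE' := (hu'.energy_le hpq (hf.restrict _)).trans hfU'
  have huI : MemSobolev p (subgraph m) u Du := hu.memSobolev.mono hUm hIU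
  have huI' : MemSobolev p (subgraph m) u' Du' := hu'.memSobolev.mono hUm' hIU'
  -- The midpoint is the common competitor for both minimality inequalities.
  set w : ℝ × ℝ → ℝ := fun z => (1 / 2) * (u z + u' z) with hwdef
  set Dw : ℝ × ℝ → Vec := fun z => (1 / 2 : ℝ) • (Du z + Du' z) with hDwdef
  have hw : MemSobolev p (subgraph m) w Dw := (huI.add hp.le huI').const_mul (1 / 2)
  have iu := huI.integrable_energy hp0
  have iu' := huI'.integrable_energy hp0
  have iw := hw.integrable_energy hp0
  have split := hu.memSobolev.energy_add_diff hp0 hUm'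
  have split' := hu'.memSobolev.energy_add_diff hp0 hUm
  rw [← hI] at split
  rw [inter_comm, ← hI] at split'
  have n1 := energy_nonneg p (U \ U') u Du
  have n2 := energy_nonneg p (U' \ U) u' Du'
  have hwle : energy p (subgraph m) w Dw ≤
      1 / 2 * (energy p (subgraph m) u Du + energy p (subgraph m) u' Du') := by
    simp only [energy]
    rw [← integral_add iu iu', ← integral_const_mul]
    refine integral_mono iw ((iu.add iu').const_mul _) fun z => ?_
    have h1 := norm_half_add_rpow_le hp.le (u z) (u' z)
    have h2 := norm_half_add_rpow_le hp.le (Du z) (Du' z)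
    simp only [smul_eq_mul] at h1
    simp only [hwdef, hDwdef]
    linarith
  have hwM : energy p (subgraph m) w Dw ≤ M := by linarith
  have a1 := hu.integral_mul_le_of_subset hpq hh hmc ha0 hb0 hη hM hmh ham hb hcm hf hfU hw hwM
  have a2 := hu'.integral_mul_le_of_subset hpq hh' hmc ha0 hb0 hη hM hmh' ham hb' hcm' hf hfU'
    hw hwM
  have b1 := hu.energy_le_integral_of_subset hpq hh hmc ha0 hb0 hη hM hmh ham hb hcm hf hfU
  have b2 := hu'.energy_le_integral_of_subset hpq hh' hmc ha0 hb0 hη hM hmh' ham hb' hcm' hf hfU'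
  have hconj : ENNReal.HolderConjugate (ENNReal.ofReal q) (ENNReal.ofReal p) :=
    hpq.symm.ennrealOfReal
  have hfw : ∫ z in subgraph m, f z * w z =
      1 / 2 * ((∫ z in subgraph m, f z * u z) + ∫ z in subgraph m, f z * u' z) := by
    have i1 : Integrable (fun z => f z * u z) (volume.restrict (subgraph m)) :=
      (hf.restrict _).integrable_mul huI.memLp
    have i2 : Integrable (fun z => f z * u' z) (volume.restrict (subgraph m)) :=
      (hf.restrict _).integrable_mul huI'.memLp
    rw [← integral_add i1 i2, ← integral_const_mul]
    refine integral_congr_ae (Eventually.of_forall fun z => ?_)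
    simp only [hwdef]
    ring
  have hsub : energy p (subgraph m) (fun z => u z - u' z) (fun z => Du z - Du' z) ≤
      θ * (energy p (subgraph m) u Du + energy p (subgraph m) u' Du') +
        C * (1 / 2 * (energy p (subgraph m) u Du + energy p (subgraph m) u' Du') -
          energy p (subgraph m) w Dw) := by
    have i1 : Integrable (fun z => (‖u z‖ ^ p + ‖Du z‖ ^ p) + (‖u' z‖ ^ p + ‖Du' z‖ ^ p))
        (volume.restrict (subgraph m)) := iu.add iu'
    have i2 : Integrable (fun z => 1 / 2 * ((‖u z‖ ^ p + ‖Du z‖ ^ p) +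
        (‖u' z‖ ^ p + ‖Du' z‖ ^ p)) - (‖w z‖ ^ p + ‖Dw z‖ ^ p))
        (volume.restrict (subgraph m)) := (i1.const_mul (1 / 2)).sub iw
    have i3 := (i1.const_mul θ).add (i2.const_mul C)
    have e : θ * (energy p (subgraph m) u Du + energy p (subgraph m) u' Du') +
        C * (1 / 2 * (energy p (subgraph m) u Du + energy p (subgraph m) u' Du') -
          energy p (subgraph m) w Dw) = ∫ z in subgraph m,
        (θ * ((‖u z‖ ^ p + ‖Du z‖ ^ p) + (‖u' z‖ ^ p + ‖Du' z‖ ^ p)) +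
        C * (1 / 2 * ((‖u z‖ ^ p + ‖Du z‖ ^ p) + (‖u' z‖ ^ p + ‖Du' z‖ ^ p)) -
          (‖w z‖ ^ p + ‖Dw z‖ ^ p))) := by
      simp only [energy]
      rw [← integral_add iu iu', ← integral_const_mul, ← integral_const_mul,
        ← integral_sub (i1.const_mul (1 / 2)) iw, ← integral_const_mul,
        ← integral_add (i1.const_mul θ) (i2.const_mul C)]
    rw [e, energy]
    refine integral_mono ((huI.sub hp.le huI').integrable_energy hp0) i3 fun z => ?_
    have h1 := hconv (u z) (u' z)
    have h2 := hconv' (Du z) (Du' z)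
    simp only [smul_eq_mul] at h1
    simp only [hwdef, hDwdef]
    linarith
  rw [← hI]
  set E := energy p U u Du
  set E' := energy p U' u' Du'
  set A := energy p (subgraph m) u Du
  set A' := energy p (subgraph m) u' Du'
  set B := energy p (subgraph m) w Dw
  set s₁ := stretchFactor p b η ^ (1 / p)
  set s₂ := (stripFactor p b η * (1 + η)) ^ (1 / p)
  -- The loads of `u` and `u'` over the intersection add up to twice that of `w`. Bounding the
  -- latter by both minimality inequalities leaves `(E + E') / p` against `2 B / p` plus errors;
  -- multiply by `p / 2`.
  have hdefect : 1 / 2 * (E + E') - B ≤ M * (η + p * (s₁ + 2 * s₂)) := by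
    have h1 : (E + E') * (1 / p) ≤ 2 * B * (1 / p) + 2 * (η * M) * (1 / p) +
        2 * (M * (s₁ + 2 * s₂)) := by
      have h3 : 1 / q = 1 - 1 / p := by
        have := hpq.inv_add_inv_eq_one
        simp only [one_div]; linarith
      rw [div_eq_mul_one_div E, h3, div_eq_mul_one_div B, div_eq_mul_one_div (η * M)] at a1
      rw [div_eq_mul_one_div E', h3, div_eq_mul_one_div B, div_eq_mul_one_div (η * M)] at a2
      linarith
    have h2 := mul_le_mul_of_nonneg_left h1 hp0.le
    have e1 : p * ((E + E') * (1 / p)) = E + E' := by field_simp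
    have e2 : p * (2 * B * (1 / p) + 2 * (η * M) * (1 / p) + 2 * (M * (s₁ + 2 * s₂))) =
        2 * B + 2 * (η * M) + 2 * p * (M * (s₁ + 2 * s₂)) := by field_simp
    rw [e1, e2] at h2
    linarith
  set σ := η + p * (s₁ + 2 * s₂)
  -- The left side of `hdefect` is the midpoint defect over the intersection plus half the energies
  -- on the set differences. Both are nonnegative, so each is at most `M * σ`, whence the constant
  -- `C + 2`.
  have hD : 1 / 2 * (A + A') - B ≤ M * σ := by linarith
  have hAA : A + A' ≤ 2 * M := by linarith
  have h6 : C * (1 / 2 * (A + A') - B) ≤ C * (M * σ) := by gcongr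
  have h7 : θ * (A + A') ≤ θ * (2 * M) := by gcongr
  linarith

/-! ### Thin domains and rescaled norms. -/

theorem exists_mem_Ioo_castSucc_succ {N : ℕ} {ξ : Fin (N + 1) → ℝ} {x : ℝ} (h0 : ξ 0 < x)
    (h1 : x < ξ (Fin.last N)) (hx : x ∉ range ξ) :
    ∃ i : Fin N, x ∈ Ioo (ξ i.castSucc) (ξ i.succ) := by
  by_contra! hcon
  have key : ∀ i : Fin (N + 1), ξ i < x := by
    intro i
    induction i using Fin.induction with
    | zero => exact h0
    | succ i ih =>
      by_contra hle
      exact hcon i ⟨ih, lt_of_le_of_ne (not_lt.1 hle) fun h => hx ⟨_, h.symm⟩⟩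
  exact (key (Fin.last N)).not_gt h1

theorem HypH.continuousOffFinite {G₀ G₁ : ℝ} {G : ℝ → ℝ → ℝ} (hG : HypH G₀ G₁ G) (ε : ℝ) :
    ContinuousOffFinite fun x => ε * profile G ε x := by
  obtain ⟨N, ξ, -, h0, h1, hreg⟩ := hG.piecewise
  refine ⟨range ξ, finite_range ξ, fun x hx => ContinuousAt.continuousWithinAt ?_⟩
  obtain ⟨i, hi⟩ := exists_mem_Ioo_castSucc_succ (h0 ▸ hx.1.1) (h1 ▸ hx.1.2) hx.2
  have hc : ContinuousAt (fun z : ℝ × ℝ => G z.1 z.2) (x, x / ε) :=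
    (hreg i).1.continuousOn.continuousAt
      (prod_mem_nhds (Ioo_mem_nhds hi.1 hi.2) univ_mem)
  have hl : ContinuousAt (fun x : ℝ => ((x, x / ε) : ℝ × ℝ)) x := by fun_prop
  exact (ContinuousAt.comp (f := fun x : ℝ => ((x, x / ε) : ℝ × ℝ)) hc hl).const_mul ε

theorem thinDomain_eq_subgraph (G : ℝ → ℝ → ℝ) (ε : ℝ) :
    thinDomain G ε = subgraph fun x => ε * profile G ε x := rfl

theorem ofReal_rpow_neg_one_div_rpow {ε p : ℝ} (hε : 0 < ε) (hp : 0 < p) :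
    (ENNReal.ofReal ε ^ (-(1 / p))) ^ p = ENNReal.ofReal ε⁻¹ := by
  rw [← ENNReal.rpow_mul, neg_mul, one_div_mul_cancel hp.ne', ENNReal.rpow_neg_one,
    ENNReal.ofReal_inv_of_pos hε]

theorem MemSobolev.rescaledSobolevNorm_rpow {ε p : ℝ} (hε : 0 < ε) (hp : 0 < p)
    {S T : Set (ℝ × ℝ)} {w : ℝ × ℝ → ℝ} {Dw : ℝ × ℝ → Vec} (hw : MemSobolev p S w Dw)
    (hTS : T ⊆ S) :
    rescaledSobolevNorm ε p T w Dw ^ p = ENNReal.ofReal (ε⁻¹ * energy p T w Dw) := by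
  rw [rescaledSobolevNorm, sobolevNorm, ENNReal.mul_rpow_of_nonneg _ _ hp.le,
    ofReal_rpow_neg_one_div_rpow hε hp, ← ENNReal.rpow_mul, one_div_mul_cancel hp.ne',
    ENNReal.rpow_one, hw.lintegral_energy hp hTS, ENNReal.ofReal_mul (by positivity)]

/-- This supplies the bound `M = C ^ q * ε`, whose factor `ε` cancels the `ε⁻¹` of the rescaled
energies. -/
theorem integral_norm_rpow_le_of_rescaledLpNorm_le {ε q : ℝ} (hε : 0 < ε) (hq : 0 < q) {C : ℝ≥0}
    {U : Set (ℝ × ℝ)} {f : ℝ × ℝ → ℝ} (hf : MemLp f (ENNReal.ofReal q) volume)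
    (h : rescaledLpNorm ε q U f ≤ (C : ℝ≥0∞)) :
    ∫ z in U, ‖f z‖ ^ q ≤ (C : ℝ) ^ q * ε := by
  have h1 := ENNReal.rpow_le_rpow h hq.le
  rw [rescaledLpNorm, ENNReal.mul_rpow_of_nonneg _ _ hq.le, ofReal_rpow_neg_one_div_rpow hε hq,
    eLpNorm_eq_lintegral_rpow_enorm_toReal (by simpa using hq) ENNReal.ofReal_ne_top,
    ENNReal.toReal_ofReal hq.le,
    ← ENNReal.rpow_mul, one_div_mul_cancel hq.ne', ENNReal.rpow_one,
    lintegral_enorm_rpow_eq hq (hf.restrict U), ← ENNReal.ofReal_mul (by positivity),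
    ← ENNReal.ofReal_coe_nnreal, ENNReal.ofReal_rpow_of_nonneg C.coe_nonneg hq.le,
    ENNReal.ofReal_le_ofReal_iff (by positivity), inv_mul_le_iff₀ hε] at h1
  rwa [mul_comm]

/-- The error due to a relative perturbation `η` of the height of a subgraph. -/
noncomputable def perturbationError (p b η : ℝ) : ℝ :=
  η + p * (stretchFactor p b η ^ (1 / p) + 2 * (stripFactor p b η * (1 + η)) ^ (1 / p))

theorem perturbationError_nonneg {p b η : ℝ} (hp : 0 ≤ p) (hb : 0 ≤ b) (hη : 0 ≤ η) :
    0 ≤ perturbationError p b η := by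
  have := stretchFactor_nonneg (p := p) hb hη
  have := stripFactor_nonneg (p := p) hb hη
  unfold perturbationError
  positivity

theorem tendsto_perturbationError {p : ℝ} (hp : 1 < p) (b : ℝ) :
    Tendsto (perturbationError p b) (𝓝 0) (𝓝 0) := by
  have hp0 : 0 < p := by linarith
  have hc : Continuous (perturbationError p b) := by
    unfold perturbationError stretchFactor stripFactor
    have h1 : Continuous fun x : ℝ => x ^ (1 / p) := Real.continuous_rpow_const (by positivity)
    have h2 : Continuous fun x : ℝ => x ^ (p - 1) := Real.continuous_rpow_const (by linarith)
    have h3 : Continuous fun η : ℝ => (b * (b * η) ^ (p - 1)) ^ (1 / p) :=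
      h1.comp ((h2.comp (continuous_const.mul continuous_id)).const_mul b)
    have h4 : Continuous fun η : ℝ => (η * (2 ^ (p - 1) * (1 + b ^ p)) * (1 + η)) ^ (1 / p) :=
      h1.comp (by fun_prop)
    fun_prop
  have h0 : perturbationError p b 0 = 0 := by
    have e1 : (0 : ℝ) ^ (p - 1) = 0 := Real.zero_rpow (by linarith)
    have e2 : (0 : ℝ) ^ (1 / p) = 0 := Real.zero_rpow (by positivity)
    simp only [perturbationError, stretchFactor, stripFactor, mul_zero, zero_mul, e1, e2, add_zero]
  simpa [h0] using hc.tendsto 0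

theorem rescaledSobolevNorm_sub_add_le {p q : ℝ} (hpq : p.HolderConjugate q) {G₀ G₁ ε₀ : ℝ}
    {C : ℝ≥0} {G G' : ℝ → ℝ → ℝ} (hG : HypH G₀ G₁ G) (hG' : HypH G₀ G₁ G') {ε : ℝ} (hε : 0 < ε)
    (hεε₀ : ε ≤ ε₀) {δ : ℝ≥0}
    (hδ : ∀ x ∈ Ioo (0 : ℝ) 1, |profile G ε x - profile G' ε x| ≤ (δ : ℝ))
    {f u u' : ℝ × ℝ → ℝ} {Du Du' : ℝ × ℝ → Vec} (hf : MemLp f (ENNReal.ofReal q) volume)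
    (hfC : rescaledLpNorm ε q (thinDomain G ε ∪ thinDomain G' ε) f ≤ (C : ℝ≥0∞))
    (hu : IsWeakSolution p (thinDomain G ε) f u Du)
    (hu' : IsWeakSolution p (thinDomain G' ε) f u' Du') {θ c : ℝ} (hθ : 0 ≤ θ) (hc : 0 ≤ c)
    (hconv : ∀ a b : ℝ, ‖a - b‖ ^ p ≤ θ * (‖a‖ ^ p + ‖b‖ ^ p) +
      c * (1 / 2 * (‖a‖ ^ p + ‖b‖ ^ p) - ‖(1 / 2 : ℝ) • (a + b)‖ ^ p))
    (hconv' : ∀ a b : Vec, ‖a - b‖ ^ p ≤ θ * (‖a‖ ^ p + ‖b‖ ^ p) +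
      c * (1 / 2 * (‖a‖ ^ p + ‖b‖ ^ p) - ‖(1 / 2 : ℝ) • (a + b)‖ ^ p)) :
    rescaledSobolevNorm ε p (thinDomain G ε ∩ thinDomain G' ε)
          (fun z => u z - u' z) (fun z => Du z - Du' z) ^ p +
        rescaledSobolevNorm ε p (thinDomain G ε \ thinDomain G' ε) u Du ^ p +
        rescaledSobolevNorm ε p (thinDomain G' ε \ thinDomain G ε) u' Du' ^ p ≤
      ENNReal.ofReal ((C : ℝ) ^ q *
        (2 * θ + (c + 2) * perturbationError p (max (ε₀ * G₁) 0) (δ / G₀))) := by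
  have hp0 := hpq.pos
  have hG0 := hG.pos
  have hG1 : 0 < G₁ := by
    have := hG.bounds (1 / 2) (by norm_num) 0
    linarith
  have hεG₁ : ε * G₁ ≤ max (ε₀ * G₁) 0 := le_max_of_le_left (by gcongr)
  have hη : 0 ≤ (δ : ℝ) / G₀ := by positivity
  -- With `a = ε * G₀`, the relative perturbation `η = δ / G₀` is independent of `ε`.
  have hηa : (δ : ℝ) / G₀ * (ε * G₀) = ε * δ := by field_simp
  have lower : ∀ {H : ℝ → ℝ → ℝ}, HypH G₀ G₁ H → ∀ x ∈ Ioo (0 : ℝ) 1,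
      ε * G₀ ≤ ε * profile H ε x := fun hH x hx =>
    mul_le_mul_of_nonneg_left (hH.bounds x hx _).1 hε.le
  have upper : ∀ {H : ℝ → ℝ → ℝ}, HypH G₀ G₁ H → ∀ x ∈ Ioo (0 : ℝ) 1,
      ε * profile H ε x ≤ max (ε₀ * G₁) 0 := fun hH x hx =>
    (mul_le_mul_of_nonneg_left (hH.bounds x hx _).2 hε.le).trans hεG₁
  have hfM := integral_norm_rpow_le_of_rescaledLpNorm_le hε hpq.symm.pos hf hfC
  rw [thinDomain_eq_subgraph, thinDomain_eq_subgraph] at *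
  have key := energy_sub_add_energy_diff_le hpq (hG.continuousOffFinite ε)
    (hG'.continuousOffFinite ε) (a := ε * G₀) (by positivity) (le_max_right (ε₀ * G₁) 0) hη
    (by positivity) (lower hG) (lower hG') (upper hG) (upper hG')
    (fun x hx => by
      rw [← mul_sub, abs_mul, abs_of_pos hε, hηa]
      exact mul_le_mul_of_nonneg_left (hδ x hx) hε.le) hu hu' hf hfM hθ hc hconv hconv'
  have hUm := measurableSet_subgraph (hG.continuousOffFinite ε)
  have hUm' := measurableSet_subgraph (hG'.continuousOffFinite ε)
  have hsub := (hu.memSobolev.mono hUm inter_subset_left).sub hpq.lt.le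
    (hu'.memSobolev.mono hUm' inter_subset_right)
  rw [hsub.rescaledSobolevNorm_rpow hε hp0 subset_rfl,
    hu.memSobolev.rescaledSobolevNorm_rpow hε hp0 sdiff_subset,
    hu'.memSobolev.rescaledSobolevNorm_rpow hε hp0 sdiff_subset,
    ← ENNReal.ofReal_add (mul_nonneg (by positivity) (energy_nonneg _ _ _ _))
      (mul_nonneg (by positivity) (energy_nonneg _ _ _ _)),
    ← ENNReal.ofReal_add (add_nonneg (mul_nonneg (by positivity) (energy_nonneg _ _ _ _))
      (mul_nonneg (by positivity) (energy_nonneg _ _ _ _)))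
      (mul_nonneg (by positivity) (energy_nonneg _ _ _ _)), ← mul_add, ← mul_add]
  refine ENNReal.ofReal_le_ofReal ?_
  rw [inv_mul_le_iff₀ hε]
  refine key.trans_eq ?_
  unfold perturbationError
  ring

end ThinDomain

/-! ### The stability theorem. -/

/-- The neighbourhood filter `𝓝 0` is not punctured, so the convergence of `ρ` includes `ρ 0 = 0`.
-/
theorem mainTheorem2 (p q : ℝ) (hpq : p.HolderConjugate q) (G₀ G₁ : ℝ) (ε₀ : ℝ) (C : ℝ≥0) :
    ∃ ρ : ℝ≥0 → ℝ≥0, Tendsto ρ (𝓝 0) (𝓝 0) ∧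
      ∀ (G Ghat : ℝ → ℝ → ℝ), ThinDomain.HypH G₀ G₁ G → ThinDomain.HypH G₀ G₁ Ghat →
      ∀ (ε : ℝ), 0 < ε → ε ≤ ε₀ →
      ∀ (δ : ℝ≥0),
        (∀ x ∈ Ioo (0 : ℝ) 1,
          |ThinDomain.profile G ε x - ThinDomain.profile Ghat ε x| ≤ (δ : ℝ)) →
      ∀ (f : ℝ × ℝ → ℝ), MemLp f (ENNReal.ofReal q) volume →
        ThinDomain.rescaledLpNorm ε q
          (ThinDomain.thinDomain G ε ∪ ThinDomain.thinDomain Ghat ε) f ≤ (C : ℝ≥0∞) →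
      ∀ (u : ℝ × ℝ → ℝ) (Du : ℝ × ℝ → ThinDomain.Vec)
        (uhat : ℝ × ℝ → ℝ) (Duhat : ℝ × ℝ → ThinDomain.Vec),
        ThinDomain.IsWeakSolution p (ThinDomain.thinDomain G ε) f u Du →
        ThinDomain.IsWeakSolution p (ThinDomain.thinDomain Ghat ε) f uhat Duhat →
        ThinDomain.rescaledSobolevNorm ε p
            (ThinDomain.thinDomain G ε ∩ ThinDomain.thinDomain Ghat ε)
            (fun z => u z - uhat z) (fun z => Du z - Duhat z) ^ p +
          ThinDomain.rescaledSobolevNorm ε p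
            (ThinDomain.thinDomain G ε \ ThinDomain.thinDomain Ghat ε) u Du ^ p +
          ThinDomain.rescaledSobolevNorm ε p
            (ThinDomain.thinDomain Ghat ε \ ThinDomain.thinDomain G ε) uhat Duhat ^ p
        ≤ (ρ δ : ℝ≥0∞) := by
  by_cases hG0 : 0 < G₀
  swap
  · exact ⟨fun _ => 0, tendsto_const_nhds, fun G _ hG => absurd hG.pos hG0⟩
  have hp0 := hpq.pos
  -- The height bound is fixed before any profile is given, when the signs of `ε₀` and `G₁` are
  -- still unknown; the maximum keeps it nonnegative.
  set b := max (ε₀ * G₁) 0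
  have herr : Tendsto (fun δ : ℝ≥0 => (ThinDomain.perturbationError p b (δ / G₀)).toNNReal)
      (𝓝 0) (𝓝 0) := by
    have h1 : Tendsto (fun δ : ℝ≥0 => (δ : ℝ) / G₀) (𝓝 0) (𝓝 0) := by
      have : Continuous fun δ : ℝ≥0 => (δ : ℝ) / G₀ := by fun_prop
      simpa using this.tendsto 0
    simpa [Function.comp_def] using (continuous_real_toNNReal.tendsto 0).comp
      ((ThinDomain.tendsto_perturbationError hpq.lt b).comp h1)
  obtain ⟨ρ, hρ, hbound⟩ := ThinDomain.exists_modulus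
    -- The relation collects every value `t` that the left side takes for some admissible data, so
    -- that a single modulus serves them all.
    (fun δ t => ∃ (G Ghat : ℝ → ℝ → ℝ) (ε : ℝ) (f u uhat : ℝ × ℝ → ℝ)
      (Du Duhat : ℝ × ℝ → ThinDomain.Vec), ThinDomain.HypH G₀ G₁ G ∧
      ThinDomain.HypH G₀ G₁ Ghat ∧ 0 < ε ∧ ε ≤ ε₀ ∧
      (∀ x ∈ Ioo (0 : ℝ) 1,
        |ThinDomain.profile G ε x - ThinDomain.profile Ghat ε x| ≤ (δ : ℝ)) ∧
      MemLp f (ENNReal.ofReal q) volume ∧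
      ThinDomain.rescaledLpNorm ε q
        (ThinDomain.thinDomain G ε ∪ ThinDomain.thinDomain Ghat ε) f ≤ (C : ℝ≥0∞) ∧
      ThinDomain.IsWeakSolution p (ThinDomain.thinDomain G ε) f u Du ∧
      ThinDomain.IsWeakSolution p (ThinDomain.thinDomain Ghat ε) f uhat Duhat ∧
      t = ThinDomain.rescaledSobolevNorm ε p
            (ThinDomain.thinDomain G ε ∩ ThinDomain.thinDomain Ghat ε)
            (fun z => u z - uhat z) (fun z => Du z - Duhat z) ^ p +
          ThinDomain.rescaledSobolevNorm ε p
            (ThinDomain.thinDomain G ε \ ThinDomain.thinDomain Ghat ε) u Du ^ p +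
          ThinDomain.rescaledSobolevNorm ε p
            (ThinDomain.thinDomain Ghat ε \ ThinDomain.thinDomain G ε) uhat Duhat ^ p)
    herr (2 * C ^ q) (by
      intro θ hθ
      obtain ⟨c₁, hc₁, h₁⟩ := ThinDomain.exists_norm_sub_rpow_le (E := ℝ) hpq.lt (θ := θ) hθ
      obtain ⟨c₂, hc₂, h₂⟩ :=
        ThinDomain.exists_norm_sub_rpow_le (E := ThinDomain.Vec) hpq.lt (θ := θ) hθ
      lift c₁ to ℝ≥0 using hc₁
      lift c₂ to ℝ≥0 using hc₂
      -- The convexity constants for values and for gradients are replaced by their maximum, which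
      -- is legitimate because the convexity defect is nonnegative.
      have enlarge : ∀ {E : Type} [NormedAddCommGroup E] [NormedSpace ℝ E] {c : ℝ≥0},
          c ≤ max c₁ c₂ → (∀ a b : E, ‖a - b‖ ^ p ≤ θ * (‖a‖ ^ p + ‖b‖ ^ p) +
            c * (1 / 2 * (‖a‖ ^ p + ‖b‖ ^ p) - ‖(1 / 2 : ℝ) • (a + b)‖ ^ p)) →
          ∀ a b : E, ‖a - b‖ ^ p ≤ θ * (‖a‖ ^ p + ‖b‖ ^ p) + (max c₁ c₂ : ℝ≥0) *
            (1 / 2 * (‖a‖ ^ p + ‖b‖ ^ p) - ‖(1 / 2 : ℝ) • (a + b)‖ ^ p) := by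
        intro E _ _ c hc h a b
        have hd := sub_nonneg.2 (ThinDomain.norm_half_add_rpow_le hpq.lt.le a b)
        exact (h a b).trans (by gcongr)
      refine ⟨(max c₁ c₂ + 2) * C ^ q, ?_⟩
      rintro δ t ⟨G, Ghat, ε, f, u, uhat, Du, Duhat, hG, hGhat, hε, hε₀, hδ, hf, hfC, hu, huhat,
        rfl⟩
      refine (ThinDomain.rescaledSobolevNorm_sub_add_le hpq hG hGhat hε hε₀ hδ hf hfC hu huhat
        θ.coe_nonneg (max c₁ c₂).coe_nonneg (enlarge (le_max_left _ _) h₁)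
        (enlarge (le_max_right _ _) h₂)).trans ?_
      have hpe := ThinDomain.perturbationError_nonneg hp0.le (le_max_right (ε₀ * G₁) 0)
        (by positivity : (0 : ℝ) ≤ δ / G₀)
      rw [← ENNReal.ofReal_coe_nnreal]
      refine ENNReal.ofReal_le_ofReal (le_of_eq ?_)
      push_cast
      rw [Real.coe_toNNReal _ hpe]
      ring)
  refine ⟨ρ, hρ, ?_⟩
  intro G Ghat hG hGhat ε hε hε₀ δ hδ f hf hfC u Du uhat Duhat hu huhat
  exact hbound δ _ ⟨G, Ghat, ε, f, u, uhat, Du, Duhat, hG, hGhat, hε, hε₀, hδ, hf, hfC, hu, huhat,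
    rfl⟩
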